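/- Let $(\mathbb X,\mathcal X)$ be a measurable space whose diagonal is measurable in $\mathbb X\times\mathbb X$ (for instance any standard Borel space), let $H$ be a nonatomic probability measure on $\mathbb X$, and let $\alpha,\tau>0$. Say that a random measure $G$ on $\mathbb X$ is a gamma process, $G\sim\Gamma(\alpha,\tau,H)$, if almost surely $G=\sum_{k=1}^\infty w_k\delta_{X_k}$ with all $w_k>0$, the masses $G(A_1),\dots,G(A_n)$ of pairwise disjoint measurable sets are independent, and $G(A)\sim\operatorname{Gamma}(\alpha H(A),\tau)$ (shape, rate; $\operatorname{Gamma}(0,\tau)=\delta_0$) for every measurable $A$. Let $G\sim\Gamma(\alpha,\tau,H)$. Given $G$, let $(Y_\ell,Z_\ell)$, $\ell=1,\dots,L$, be conditionally i.i.d., where $Y_\ell=(Y_{\ell1},\dots,Y_{\ell m})\in\mathbb X^m$ is a Plackett--Luce top-$m$ list, i.e. for every list $(y_1,\dots,y_m)$ of distinct items $$P(Y_\ell=(y_1,\dots,y_m)\mid G)=\prod_{i=1}^m\frac{G(\{y_i\})}{G(\mathbb X\setminus\{y_1,\dots,y_{i-1}\})}$$ (and lists with a repeated item have probability $0$), and where,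 given $G$ and $Y_\ell$, the latent inter-arrival times $Z_{\ell1},\dots,Z_{\ell m}$ are independent with $Z_{\ell i}\sim\operatorname{Exp}\bigl(G(\mathbb X\setminus\{Y_{\ell1},\dots,Y_{\ell\,i-1}\})\bigr)$. Let $X^*_1,\dots,X^*_K$ be the distinct items occurring among the $L$ lists, let $n_k$ be the number of occurrences of $X^*_k$ in the lists, and let $\delta_{\ell ik}=0$ if $Y_{\ell j}=X^*_k$ for some $j<i$, and $\delta_{\ell ik}=1$ otherwise. Then a regular conditional distribution of $G$ given $(Y_\ell,Z_\ell)_{\ell=1}^L$ exists and is given, for all values of the data with $Z_{\ell i}\ge 0$, by the law of $$G^*+\sum_{k=1}^K w^*_k\,\delta_{X^*_k},$$ where $G^*,w^*_1,\dots,w^*_K$ are mutually independent, $$G^*\sim\Gamma\Bigl(\alpha,\ \tau+\sum_{\ell=1}^L\sum_{i=1}^m Z_{\ell i},\ H\Bigr),\qquad w^*_k\sim\operatorname{Gamma}\Bigl(n_k,\ \tau+\sum_{\ell=1}^L\sum_{i=1}^m\delta_{\ell ik}Z_{\ell i}\Bigr).$$ -/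

import Mathlib

open MeasureTheory ProbabilityTheory

noncomputable section

/-- The `Gamma(a, r)` distribution (shape `a`, rate `r`), with the usual convention that
`Gamma(0, r)` is the point mass at `0`. -/
def gammaLaw (a r : ℝ) : Measure ℝ :=
  open Classical in if a = 0 then Measure.dirac 0 else gammaMeasure a r

/-- `γ` is the law of a gamma process `Γ(α, τ, H)` on `X`: a law on measures `g` on `X` under which
`g = ∑ₖ wₖ δ_{xₖ}` almost surely (with infinitely many positive masses), the masses of disjoint
sets are independent, and `g A ∼ Gamma(α H(A), τ)` for every measurable `A`. -/
structure IsGammaProcessLaw {X : Type*} [MeasurableSpace X] (α τ : ℝ) (H : Measure X)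
    (γ : Measure (Measure X)) : Prop where
  isProbabilityMeasure : IsProbabilityMeasure γ
  atomic : ∀ᵐ g ∂γ, ∃ (w : ℕ → ℝ) (x : ℕ → X), (∀ k, 0 < w k) ∧
    g = Measure.sum fun k => ENNReal.ofReal (w k) • Measure.dirac (x k)
  indep : ∀ (n : ℕ) (A : Fin n → Set X), (∀ i, MeasurableSet (A i)) →
    (∀ i j, i ≠ j → Disjoint (A i) (A j)) → iIndepFun (fun i (g : Measure X) => g (A i)) γ
  marginal : ∀ A : Set X, MeasurableSet A →
    γ.map (fun g => g A) = (gammaLaw (α * H.real A) τ).map ENNReal.ofReal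

/-- The items still available at stage `i` of the list `y`: `X ∖ {y₁, …, y_{i-1}}`. -/
def remaining {X : Type*} {m : ℕ} (y : Fin m → X) (i : Fin m) : Set X :=
  {x | ∀ j < i, y j ≠ x}

/-- The Plackett–Luce probability of the top-`m` list `y` given the atomic measure `g`:
`∏ᵢ g{yᵢ} / g(X ∖ {y₁, …, y_{i-1}})` if the items of `y` are distinct, and `0` otherwise. -/
def plackettLuceProb {X : Type*} [MeasurableSpace X] {m : ℕ} (g : Measure X) (y : Fin m → X) :
    ENNReal :=
  open Classical in
  if Function.Injective y then ∏ i, g {y i} / g (remaining y i) else 0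

/-- The conditional law of the inter-arrival times given `g` and the list `y`: independent
exponential variables, the `i`-th one of rate `g(X ∖ {y₁, …, y_{i-1}})`. -/
def interArrivalLaw {X : Type*} [MeasurableSpace X] {m : ℕ} (g : Measure X) (y : Fin m → X) :
    Measure (Fin m → ℝ) :=
  Measure.pi fun i => expMeasure (g (remaining y i)).toReal

/-- The joint conditional law, given `g`, of one Plackett–Luce top-`m` list and its inter-arrival
times: the list is `y` with probability `plackettLuceProb g y`, and given the list `y` the times
have law `interArrivalLaw g y`. -/
def rankingLaw {X : Type*} [MeasurableSpace X] (m : ℕ) (g : Measure X) :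
    Measure ((Fin m → X) × (Fin m → ℝ)) :=
  Measure.sum fun y : Fin m → X =>
    plackettLuceProb g y • (Measure.dirac y).prod (interArrivalLaw g y)

/-- A data set: `L` lists of length `m`, each with its inter-arrival times. -/
abbrev RankingData (X : Type*) (L m : ℕ) : Type _ := Fin L → (Fin m → X) × (Fin m → ℝ)

/-- The conditional law of the whole data set given `g`: the `L` lists, with their inter-arrival
times, are conditionally i.i.d. -/
def dataLaw {X : Type*} [MeasurableSpace X] (L m : ℕ) (g : Measure X) :
    Measure (RankingData X L m) :=
  Measure.pi fun _ : Fin L => rankingLaw m g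

/-- `κ` is a regular conditional distribution of `V` given `U` under `P`. -/
def IsCondLaw {Ω S T : Type*} [MeasurableSpace Ω] [MeasurableSpace S] [MeasurableSpace T]
    (P : Measure Ω) (U : Ω → S) (V : Ω → T) (κ : S → Measure T) : Prop :=
  AEMeasurable κ (P.map U) ∧
  ∀ (A : Set S) (B : Set T), MeasurableSet A → MeasurableSet B →
    P (U ⁻¹' A ∩ V ⁻¹' B) = ∫⁻ ω in U ⁻¹' A, κ (U ω) B ∂P

/-- The (finite) set of unique items `X*₁, …, X*_K` occurring among all the lists. -/
def observedItems {X : Type*} {L m : ℕ} (d : RankingData X L m) : Finset X :=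
  open Classical in Finset.univ.image fun p : Fin L × Fin m => (d p.1).1 p.2

/-- The number `n` of occurrences of the item `x` among the lists. -/
def occurrences {X : Type*} {L m : ℕ} (d : RankingData X L m) (x : X) : ℕ :=
  open Classical in (Finset.univ.filter fun p : Fin L × Fin m => (d p.1).1 p.2 = x).card

/-- The occurrence indicator `δ_{ℓ i}` of the item `x`: `0` if `x` occurs in the `ℓ`-th list before
position `i`, and `1` otherwise. -/
def occIndicator {X : Type*} {L m : ℕ} (d : RankingData X L m) (l : Fin L) (i : Fin m) (x : X) :
    ℝ :=
  open Classical in if ∃ j < i, (d l).1 j = x then 0 else 1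

/-- `ν` is the law of `G* + ∑ₖ w*ₖ δ_{X*ₖ}`, where `X*₁, …, X*_K` are the unique items in the data
`d = (y, z)`, and `G* ∼ Γ(α, τ + ∑ z_{ℓi}, H)` and `w*ₖ ∼ Gamma(nₖ, τ + ∑ δ_{ℓik} z_{ℓi})`
are mutually independent (that is, their joint law is the product of these laws). -/
def IsPosteriorLaw {X : Type*} [MeasurableSpace X] {L m : ℕ} (α τ : ℝ) (H : Measure X)
    (d : RankingData X L m) (ν : Measure (Measure X)) : Prop :=
  ∃ γ : Measure (Measure X),
    IsGammaProcessLaw α (τ + ∑ l, ∑ i, (d l).2 i) H γ ∧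
    ν = (γ.prod (Measure.pi fun x : observedItems d =>
          gammaMeasure (occurrences d x)
            (τ + ∑ l, ∑ i, occIndicator d l i x * (d l).2 i))).map
        fun q => q.1 + ∑ x : observedItems d, ENNReal.ofReal (q.2 x) • Measure.dirac (x : X)

end

open scoped ENNReal

universe u

section

/-! ### Gamma distributions -/

/-! The latent times linearise the Plackett–Luce likelihood. An exponential density of rate `r` is
`r * exp (-z r)`, and its factor `r = g(X ∖ {y₁, …, y_{i-1}})` cancels the denominator of the `i`-th
Plackett–Luce factor. Since `g` is almost surely finite and carried by a countable set, one list
with its times therefore has density `1{y distinct} * exp (-∑ᵢ zᵢ g(remaining y i))` with respect to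
`g^m ⊗ dz` (`plackettLuceProb_mul_interArrivalLaw`, `rankingLaw_eq_withDensity`).

The reference measure `g^(L×m)` still depends on `g`. The iterated Mecke formula
(`IsGammaProcessLaw.exists_mecke`) removes this dependence: drawing `g` from the gamma process and
then integrating against `g^n` is the same as drawing `y` from a fixed finite measure `Λ` (an
unnormalised Blackwell–MacQueen urn) and replacing `g` by `g + ∑ₚ wₚ δ_{yₚ}`, with the `wₚ` i.i.d.
`Exp(τ)` and independent of `g`. The one-point formula (`IsGammaProcessLaw.mecke`) comes from two
facts about gamma variables: size-biasing `Gamma(a, τ)` gives `Gamma(a + 1, τ)` with constant `a /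
τ`, and `Gamma(a + 1, τ) = Gamma(a, τ) * Exp(τ)`. It suffices to test it on finite partitions, where
the masses are independent.

At fixed data, `H` being nonatomic, `g` does not charge the items, so the exponent is linear in
`g(X)` and in each `wₚ` separately (`dataDensity_addAtoms`). Exponential tilting then only changes
rates: `g` becomes a gamma process of rate `τ + ∑ z`, and `wₚ` becomes exponential of rate `τ + ∑ δ
z`, a rate depending only on the item at `p`. Adding the `n_k` exponentials sitting at the same item
gives `Gamma(n_k, ·)`. The tilting constants make up the density of the data with respect to `Λ ⊗
dz`.

Changes of rate are realised by scaling. The posterior is thus an explicit image of the prior and of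
independent exponentials, under a map depending measurably on the data; no new gamma process has to
be constructed. -/

instance sigmaFinite_gammaMeasure (a r : ℝ) : SigmaFinite (gammaMeasure a r) := by
  unfold gammaMeasure gammaPDF
  infer_instance

instance sigmaFinite_expMeasure (r : ℝ) : SigmaFinite (expMeasure r) :=
  sigmaFinite_gammaMeasure 1 r

lemma gammaLaw_zero (r : ℝ) : gammaLaw 0 r = Measure.dirac 0 := by simp [gammaLaw]

lemma gammaLaw_of_pos {a : ℝ} (ha : 0 < a) (r : ℝ) : gammaLaw a r = gammaMeasure a r := by
  simp [gammaLaw, ha.ne']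

lemma expMeasure_eq_gammaLaw (r : ℝ) : expMeasure r = gammaLaw 1 r := by
  simp [gammaLaw, expMeasure]

lemma isProbabilityMeasure_gammaLaw {a r : ℝ} (ha : 0 ≤ a) (hr : 0 < r) :
    IsProbabilityMeasure (gammaLaw a r) := by
  rcases ha.eq_or_lt with rfl | ha
  · rw [gammaLaw_zero]; infer_instance
  · rw [gammaLaw_of_pos ha]; exact isProbabilityMeasure_gammaMeasure ha hr

lemma measurable_gammaPDF (a r : ℝ) : Measurable (gammaPDF a r) :=
  (measurable_gammaPDFReal a r).ennreal_ofReal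

lemma lintegral_gammaMeasure (a r : ℝ) {f : ℝ → ℝ≥0∞} (hf : Measurable f) :
    ∫⁻ x, f x ∂gammaMeasure a r = ∫⁻ x, gammaPDF a r x * f x := by
  rw [gammaMeasure, lintegral_withDensity_eq_lintegral_mul _ (measurable_gammaPDF a r) hf]
  rfl

lemma ae_nonneg_gammaLaw (a r : ℝ) : ∀ᵐ x ∂gammaLaw a r, 0 ≤ x := by
  by_cases ha : a = 0
  · subst ha
    rw [gammaLaw_zero, ae_dirac_iff measurableSet_Ici]
  · rw [gammaLaw, if_neg ha, gammaMeasure, ae_withDensity_iff (measurable_gammaPDF a r)]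
    refine ae_of_all _ fun x hx => ?_
    by_contra h
    exact hx (gammaPDF_of_neg (not_le.1 h))

lemma ofReal_mul_gammaPDF {a r : ℝ} (ha : 0 < a) (hr : 0 < r) {x : ℝ} (hx : x ≠ 0) :
    ENNReal.ofReal x * gammaPDF a r x = ENNReal.ofReal (a / r) * gammaPDF (a + 1) r x := by
  rcases hx.lt_or_gt with hx | hx
  · simp [gammaPDF_of_neg hx]
  · rw [gammaPDF_of_nonneg hx.le, gammaPDF_of_nonneg hx.le, ← ENNReal.ofReal_mul hx.le,
      ← ENNReal.ofReal_mul (by positivity), Real.Gamma_add_one ha.ne', Real.rpow_add_one hr.ne',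
      add_sub_cancel_right, Real.rpow_sub_one hx.ne']
    have := (Real.Gamma_pos_of_pos ha).ne'
    congr 1
    field_simp

lemma lintegral_gammaPDF_mul_exponentialPDF {a r : ℝ} (ha : 0 < a) (hr : 0 < r) (u : ℝ) :
    ∫⁻ x, gammaPDF a r x * gammaPDF 1 r (u - x) = gammaPDF (a + 1) r u := by
  rcases lt_trichotomy u 0 with hu | hu | hu
  · rw [gammaPDF_of_neg hu, lintegral_eq_zero_iff' (by
      refine ((measurable_gammaPDF a r).mul ((measurable_gammaPDF 1 r).comp ?_)).aemeasurable
      fun_prop)]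
    refine ae_of_all _ fun x => ?_
    rcases lt_or_ge x 0 with hx | hx
    · simp [gammaPDF_of_neg hx]
    · simp [gammaPDF_of_neg (show u - x < 0 by linarith)]
  · subst hu
    rw [gammaPDF_of_nonneg le_rfl, add_sub_cancel_right, Real.zero_rpow ha.ne']
    rw [mul_zero, zero_mul, ENNReal.ofReal_zero, lintegral_eq_zero_iff' (by
      refine ((measurable_gammaPDF a r).mul ((measurable_gammaPDF 1 r).comp ?_)).aemeasurable
      fun_prop)]
    have h0 : ∀ᵐ x : ℝ, x ≠ 0 := Measure.ae_ne volume 0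
    filter_upwards [h0] with x hx
    rcases hx.lt_or_gt with hx | hx
    · simp [gammaPDF_of_neg hx]
    · rw [gammaPDF_of_neg (show 0 - x < 0 by linarith), mul_zero, Pi.zero_apply]
  · have hG := Real.Gamma_pos_of_pos ha
    -- On `[0, u]` the two exponentials multiply to the constant `exp (-(r u))`, which leaves only
    -- the power `x ^ (a - 1)` to integrate.
    have key : ∀ x, gammaPDF a r x * gammaPDF 1 r (u - x) =
        (Set.Icc 0 u).indicator (fun x => ENNReal.ofReal
          (r ^ (a + 1) / Real.Gamma a * Real.exp (-(r * u)) * x ^ (a - 1))) x := by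
      intro x
      by_cases hx : x ∈ Set.Icc 0 u
      · rw [Set.indicator_of_mem hx, gammaPDF_of_nonneg hx.1,
          gammaPDF_of_nonneg (sub_nonneg.2 hx.2), ← ENNReal.ofReal_mul (by
            have := Real.rpow_nonneg hx.1 (a - 1)
            positivity), sub_self, Real.rpow_zero, Real.Gamma_one,
          Real.rpow_one, Real.rpow_add_one hr.ne',
          show -(r * u) = -(r * x) + -(r * (u - x)) by ring, Real.exp_add]
        congr 1
        ring
      · rw [Set.indicator_of_notMem hx]
        rcases lt_or_ge x 0 with h | h
        · simp [gammaPDF_of_neg h]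
        · have : u < x := by
            by_contra h'
            exact hx ⟨h, not_lt.1 h'⟩
          simp [gammaPDF_of_neg (show u - x < 0 by linarith)]
    simp_rw [key]
    rw [lintegral_indicator measurableSet_Icc, ← ofReal_integral_eq_lintegral_ofReal,
      integral_Icc_eq_integral_Ioc, ← intervalIntegral.integral_of_le hu.le,
      intervalIntegral.integral_const_mul, integral_rpow (Or.inl (by linarith)),
      gammaPDF_of_nonneg hu.le, Real.Gamma_add_one ha.ne', sub_add_cancel,
      Real.zero_rpow ha.ne', add_sub_cancel_right]
    · congr 1
      field_simp
      ring
    · refine Integrable.const_mul ?_ _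
      have := intervalIntegral.intervalIntegrable_rpow' (a := 0) (b := u) (r := a - 1) (by linarith)
      rw [intervalIntegrable_iff_integrableOn_Icc_of_le hu.le] at this
      exact this
    · filter_upwards [ae_restrict_mem measurableSet_Icc] with x hx
      have := Real.rpow_nonneg hx.1 (a - 1)
      simp only [Pi.zero_apply]
      positivity

lemma lintegral_gammaMeasure_add_exp {a r : ℝ} (ha : 0 < a) (hr : 0 < r) {f : ℝ → ℝ≥0∞}
    (hf : Measurable f) :
    ∫⁻ x, ∫⁻ w, f (x + w) ∂expMeasure r ∂gammaMeasure a r = ∫⁻ x, f x ∂gammaMeasure (a + 1) r := by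
  have hm := measurable_gammaPDF
  have h1 : ∀ x, ∫⁻ w, f (x + w) ∂expMeasure r = ∫⁻ u, gammaPDF 1 r (u - x) * f u := by
    intro x
    rw [expMeasure, lintegral_gammaMeasure _ _ (by fun_prop),
      ← lintegral_add_right_eq_self (fun u => gammaPDF 1 r (u - x) * f u) x]
    simp [add_comm]
  simp_rw [h1]
  have hm1 : Measurable fun p : ℝ × ℝ => gammaPDF 1 r (p.2 - p.1) * f p.2 := by
    refine ((hm 1 r).comp ?_).mul (hf.comp measurable_snd)
    fun_prop
  rw [lintegral_gammaMeasure _ _ hm1.lintegral_prod_right', lintegral_gammaMeasure _ _ hf]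
  have h2 : ∀ x, gammaPDF a r x * ∫⁻ u, gammaPDF 1 r (u - x) * f u =
      ∫⁻ u, gammaPDF a r x * (gammaPDF 1 r (u - x) * f u) := fun x => by
    rw [lintegral_const_mul]
    exact hm1.comp (measurable_const.prodMk measurable_id)
  simp_rw [h2]
  rw [lintegral_lintegral_swap
    (((hm a r).comp measurable_fst).mul hm1).aemeasurable]
  refine lintegral_congr fun u => ?_
  simp_rw [← mul_assoc]
  rw [lintegral_mul_const, lintegral_gammaPDF_mul_exponentialPDF ha hr]
  refine (hm a r).mul ((hm 1 r).comp ?_)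
  fun_prop

/-- The case `a = 0` is needed for cells with `H(A) = 0` and for empty blocks of positions: there
the starting law is the point mass at `0`, and one exponential gives `Gamma(1, r)`. -/
lemma lintegral_gammaLaw_add_exp {a r : ℝ} (ha : 0 ≤ a) (hr : 0 < r) {f : ℝ → ℝ≥0∞}
    (hf : Measurable f) :
    ∫⁻ x, ∫⁻ w, f (x + w) ∂expMeasure r ∂gammaLaw a r = ∫⁻ x, f x ∂gammaLaw (a + 1) r := by
  rcases ha.eq_or_lt with rfl | ha
  · have hm : Measurable fun x => ∫⁻ w, f (x + w) ∂expMeasure r :=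
      Measurable.lintegral_prod_right' (f := fun p : ℝ × ℝ => f (p.1 + p.2)) (by fun_prop)
    rw [gammaLaw_zero, lintegral_dirac' _ hm, zero_add, ← expMeasure_eq_gammaLaw]
    simp
  · rw [gammaLaw_of_pos ha, gammaLaw_of_pos (by positivity), lintegral_gammaMeasure_add_exp ha hr hf]

/-- The size-biasing identity of the gamma distribution. -/
lemma lintegral_ofReal_mul_gammaLaw {a r : ℝ} (ha : 0 ≤ a) (hr : 0 < r) {f : ℝ → ℝ≥0∞}
    (hf : Measurable f) :
    ∫⁻ x, ENNReal.ofReal x * f x ∂gammaLaw a r =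
      ENNReal.ofReal (a / r) * ∫⁻ x, ∫⁻ w, f (x + w) ∂expMeasure r ∂gammaLaw a r := by
  rcases ha.eq_or_lt with rfl | ha
  · simp [gammaLaw_zero]
  · have hm := measurable_gammaPDF
    rw [gammaLaw_of_pos ha, lintegral_gammaMeasure_add_exp ha hr hf,
      lintegral_gammaMeasure _ _ (by fun_prop), lintegral_gammaMeasure _ _ hf,
      ← lintegral_const_mul _ ((hm _ _).fun_mul hf)]
    have h0 : ∀ᵐ x : ℝ, x ≠ 0 := Measure.ae_ne volume 0
    refine lintegral_congr_ae ?_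
    filter_upwards [h0] with x hx
    rw [← mul_assoc, ← mul_assoc, mul_comm (gammaPDF a r x), ofReal_mul_gammaPDF ha hr hx]

/-- Exponential tilting of the gamma distribution. -/
lemma lintegral_exp_mul_gammaLaw {a r z : ℝ} (ha : 0 ≤ a) (hr : 0 < r) (hz : 0 ≤ z)
    {f : ℝ → ℝ≥0∞} (hf : Measurable f) :
    ∫⁻ x, ENNReal.ofReal (Real.exp (-(z * x))) * f x ∂gammaLaw a r =
      ENNReal.ofReal ((r / (r + z)) ^ a) * ∫⁻ x, f x ∂gammaLaw a (r + z) := by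
  rcases ha.eq_or_lt with rfl | ha
  · rw [gammaLaw_zero, gammaLaw_zero, lintegral_dirac' _ (by fun_prop), lintegral_dirac' _ hf]
    simp
  · have hm := measurable_gammaPDF
    rw [gammaLaw_of_pos ha, gammaLaw_of_pos ha,
      lintegral_gammaMeasure _ _ (by fun_prop), lintegral_gammaMeasure _ _ hf,
      ← lintegral_const_mul _ ((hm _ _).fun_mul hf)]
    refine lintegral_congr fun x => ?_
    rcases lt_or_ge x 0 with hx | hx
    · simp [gammaPDF_of_neg hx]
    · rw [← mul_assoc, ← mul_assoc, gammaPDF_of_nonneg hx, gammaPDF_of_nonneg hx,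
        ← ENNReal.ofReal_mul' (Real.exp_pos _).le, ← ENNReal.ofReal_mul (by positivity),
        Real.div_rpow hr.le (by positivity),
        show -((r + z) * x) = -(r * x) + -(z * x) by ring, Real.exp_add]
      congr 2
      have : (r + z) ^ a ≠ 0 := by positivity
      field_simp

lemma lintegral_const_mul_gammaLaw {a r c : ℝ} (ha : 0 ≤ a) (hr : 0 < r) (hc : 0 < c)
    {f : ℝ → ℝ≥0∞} (hf : Measurable f) :
    ∫⁻ x, f (c * x) ∂gammaLaw a r = ∫⁻ x, f x ∂gammaLaw a (r / c) := by
  rcases ha.eq_or_lt with rfl | ha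
  · rw [gammaLaw_zero, gammaLaw_zero, lintegral_dirac' _ (by fun_prop), lintegral_dirac' _ hf]
    simp
  · have hm := measurable_gammaPDF
    rw [gammaLaw_of_pos ha, gammaLaw_of_pos ha,
      lintegral_gammaMeasure _ _ (by fun_prop), lintegral_gammaMeasure _ _ hf]
    have key : ∀ x, gammaPDF a r x * f (c * x) =
        ENNReal.ofReal c * (gammaPDF a (r / c) (c * x) * f (c * x)) := by
      intro x
      rcases lt_or_ge x 0 with hx | hx
      · simp [gammaPDF_of_neg hx, gammaPDF_of_neg (mul_neg_of_pos_of_neg hc hx)]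
      · rw [← mul_assoc, gammaPDF_of_nonneg hx, gammaPDF_of_nonneg (by positivity),
          ← ENNReal.ofReal_mul hc.le, Real.div_rpow hr.le hc.le, Real.mul_rpow hc.le hx,
          Real.rpow_sub_one hc.ne', show r / c * (c * x) = r * x by field_simp]
        have : c ^ a ≠ 0 := by positivity
        congr 2
        field_simp
    simp_rw [key]
    rw [lintegral_const_mul _ (by fun_prop)]
    have := Real.map_volume_mul_left hc.ne'
    have h2 := congrArg (fun μ => ∫⁻ x, (gammaPDF a (r / c) x * f x) ∂μ) this
    simp only [lintegral_smul_measure] at h2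
    rw [lintegral_map (by fun_prop) (by fun_prop)] at h2
    rw [h2, smul_eq_mul, ← mul_assoc, ← ENNReal.ofReal_mul hc.le, abs_of_pos (by positivity),
      mul_inv_cancel₀ hc.ne']
    simp

lemma map_const_mul_gammaLaw {a r c : ℝ} (ha : 0 ≤ a) (hr : 0 < r) (hc : 0 < c) :
    (gammaLaw a r).map (fun x => c * x) = gammaLaw a (r / c) := by
  refine Measure.ext_of_lintegral _ fun f hf => ?_
  rw [lintegral_map hf (by fun_prop), lintegral_const_mul_gammaLaw ha hr hc hf]

/-! ### Products -/

lemma lintegral_pi_finset_prod {ι : Type*} [Fintype ι] {E : ι → Type*}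
    [∀ i, MeasurableSpace (E i)] (μ : ∀ i, Measure (E i)) [∀ i, SigmaFinite (μ i)]
    {f : ∀ i, E i → ℝ≥0∞} (hf : ∀ i, Measurable (f i)) :
    ∫⁻ x, ∏ i, f i (x i) ∂Measure.pi μ = ∏ i, ∫⁻ x, f i x ∂μ i := by
  have fin : ∀ (n : ℕ) (E : Fin n → Type _) [∀ i, MeasurableSpace (E i)]
      (μ : ∀ i, Measure (E i)) [∀ i, SigmaFinite (μ i)] (f : ∀ i, E i → ℝ≥0∞)
      (_ : ∀ i, Measurable (f i)),
      ∫⁻ x, ∏ i, f i (x i) ∂Measure.pi μ = ∏ i, ∫⁻ x, f i x ∂μ i := by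
    intro n
    induction n with
    | zero => intros; simp
    | succ n ih =>
      intro E _ μ _ f hf
      have hm : Measurable fun x : ∀ i : Fin n, E ((0 : Fin (n + 1)).succAbove i) =>
          ∏ i, f ((0 : Fin (n + 1)).succAbove i) (x i) :=
        Finset.measurable_prod _ fun i _ => (hf _).comp (measurable_pi_apply i)
      have h := (measurePreserving_piFinSuccAbove μ 0).lintegral_comp
        (f := fun p => f 0 p.1 * ∏ i, f ((0 : Fin (n + 1)).succAbove i) (p.2 i))
        (((hf 0).comp measurable_fst).mul (hm.comp measurable_snd))
      rw [lintegral_prod_mul (hf 0).aemeasurable hm.aemeasurable,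
        ih (fun i => E ((0 : Fin (n + 1)).succAbove i)) (fun i => μ ((0 : Fin (n + 1)).succAbove i))
          (fun i => f ((0 : Fin (n + 1)).succAbove i)) fun i => hf _,
        ← Fin.prod_univ_succAbove (fun i => ∫⁻ x, f i x ∂μ i)] at h
      rw [← h]
      exact lintegral_congr fun x => Fin.prod_univ_succAbove (fun i => f i (x i)) 0
  let e := (Fintype.equivFin ι).symm
  rw [← (measurePreserving_piCongrLeft μ e).lintegral_comp_emb
    (MeasurableEquiv.measurableEmbedding _)]
  simp_rw [← e.prod_comp, MeasurableEquiv.coe_piCongrLeft, Equiv.piCongrLeft_apply_apply]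
  exact fin _ _ _ _ fun i => hf _

lemma pi_withDensity {ι : Type*} [Fintype ι] {E : ι → Type*}
    [∀ i, MeasurableSpace (E i)] (μ : ∀ i, Measure (E i)) [∀ i, SigmaFinite (μ i)]
    {f : ∀ i, E i → ℝ≥0∞} (hf : ∀ i, Measurable (f i)) [∀ i, SigmaFinite ((μ i).withDensity (f i))] :
    Measure.pi (fun i => (μ i).withDensity (f i)) =
      (Measure.pi μ).withDensity fun x => ∏ i, f i (x i) := by
  refine Measure.pi_eq fun s hs => ?_
  rw [withDensity_apply _ (MeasurableSet.univ_pi hs),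
    ← lintegral_indicator (MeasurableSet.univ_pi hs)]
  have : ∀ x : ∀ i, E i, (Set.univ.pi s).indicator (fun x => ∏ i, f i (x i)) x =
      ∏ i, (s i).indicator (f i) (x i) := by
    intro x
    by_cases hx : x ∈ Set.univ.pi s
    · rw [Set.indicator_of_mem hx]
      exact Finset.prod_congr rfl fun i _ => (Set.indicator_of_mem (hx i trivial) _).symm
    · rw [Set.indicator_of_notMem hx]
      simp only [Set.mem_pi, Set.mem_univ, true_implies, not_forall] at hx
      obtain ⟨i, hi⟩ := hx
      exact (Finset.prod_eq_zero (Finset.mem_univ i) (Set.indicator_of_notMem hi _)).symm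
  simp_rw [this]
  rw [lintegral_pi_finset_prod μ fun i => (hf i).indicator (hs i)]
  refine Finset.prod_congr rfl fun i _ => ?_
  rw [lintegral_indicator (hs i), withDensity_apply _ (hs i)]

/-! ### Laws of random measures -/

variable {X : Type u} [MeasurableSpace X]

lemma measure_pi_ext {ι : Type*} [Fintype ι] {E : ι → Type*} [∀ i, MeasurableSpace (E i)]
    {μ ν : Measure (∀ i, E i)} [IsFiniteMeasure μ]
    (h : ∀ S : ∀ i, Set (E i), (∀ i, MeasurableSet (S i)) →
      μ (Set.univ.pi S) = ν (Set.univ.pi S)) : μ = ν := by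
  refine ext_of_generate_finite _ generateFrom_pi.symm isPiSystem_pi ?_ ?_
  · rintro _ ⟨S, hS, rfl⟩
    exact h S fun i => hS i trivial
  · have := h (fun _ => Set.univ) fun _ => .univ
    simpa using this

/-- A finite measure on the space of measures is determined by the masses of finite measurable
partitions refining a given set `B`. -/
lemma measure_ext_of_partition {μ ν : Measure (Measure X)} [IsFiniteMeasure μ]
    {B : Set X} (hB : MeasurableSet B)
    (h : ∀ (ι : Type u) [Fintype ι] (A : ι → Set X), (∀ i, MeasurableSet (A i)) →
      (∀ i j, i ≠ j → Disjoint (A i) (A j)) → (⋃ i, A i) = Set.univ →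
      (∀ i, A i ⊆ B ∨ Disjoint (A i) B) → ∀ S : ι → Set ℝ≥0∞, (∀ i, MeasurableSet (S i)) →
      μ {g | ∀ i, g (A i) ∈ S i} = ν {g | ∀ i, g (A i) ∈ S i}) : μ = ν := by
  classical
  let m : Set X → MeasurableSpace (Measure X) := fun s => (borel ℝ≥0∞).comap fun μ => μ s
  refine ext_of_generate_finite (piiUnionInter (fun n => {s | MeasurableSet[m n] s})
    {s : Set X | MeasurableSet s}) (generateFrom_piiUnionInter_measurableSet m _).symm
    (isPiSystem_piiUnionInter _ (fun s => @MeasurableSpace.isPiSystem_measurableSet _ (m s)) _)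
    ?_ ?_
  · rintro _ ⟨t, ht, f, hf, rfl⟩
    have hf' : ∀ s, ∃ S : Set ℝ≥0∞, MeasurableSet S ∧ (s ∈ t → f s = {g | g s ∈ S}) := by
      intro s
      by_cases hs : s ∈ t
      · obtain ⟨S, hS, h'⟩ := hf s hs
        refine ⟨S, ?_, fun _ => h'.symm⟩
        rwa [BorelSpace.measurable_eq (α := ℝ≥0∞)]
      · exact ⟨∅, .empty, fun h => absurd h hs⟩
    choose S hS hfS using hf'
    let I := {s // s ∈ insert B t}
    -- The cells are the membership patterns with respect to `B` and the finitely many sets in `t`.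
    -- Each of these sets is a disjoint union of cells, so its mass is a finite sum of cell masses.
    let A : (I → ULift.{u} Bool) → Set X := fun ε => {x | ∀ s : I, x ∈ s.1 ↔ (ε s).down = true}
    have hI : ∀ s : I, MeasurableSet s.1 := by
      rintro ⟨s, hs⟩
      rcases Finset.mem_insert.1 hs with rfl | hs
      · exact hB
      · exact ht hs
    have hA : ∀ ε, MeasurableSet (A ε) := by
      intro ε
      have : A ε = ⋂ s : I, {x | x ∈ s.1 ↔ (ε s).down = true} := by
        ext x; simp [A]
      rw [this]
      refine MeasurableSet.iInter fun s => ?_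
      cases hs : (ε s).down
      · have : {x | x ∈ s.1 ↔ false = true} = s.1ᶜ := by ext x; simp
        rw [this]
        exact (hI s).compl
      · have : {x | x ∈ s.1 ↔ true = true} = s.1 := by ext x; simp
        rw [this]
        exact hI s
    have hd : ∀ ε ε', ε ≠ ε' → Disjoint (A ε) (A ε') := by
      intro ε ε' hne
      rw [Set.disjoint_left]
      intro x hx hx'
      refine hne (funext fun s => ULift.ext _ _ ?_)
      have := (hx s).symm.trans (hx' s)
      exact Bool.eq_iff_iff.2 this
    have hmem : ∀ x, x ∈ A fun s => ⟨decide (x ∈ s.1)⟩ := fun x s => by simp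
    have hU : (⋃ ε, A ε) = Set.univ :=
      Set.eq_univ_of_forall fun x => Set.mem_iUnion.2 ⟨_, hmem x⟩
    have hBA : ∀ ε, A ε ⊆ B ∨ Disjoint (A ε) B := by
      intro ε
      let b : I := ⟨B, Finset.mem_insert_self _ _⟩
      cases hb : (ε b).down
      · right
        rw [Set.disjoint_left]
        intro x hx hxB
        have := (hx b).1 hxB
        simp [hb] at this
      · left
        intro x hx
        exact (hx b).2 hb
    have hmap : μ.map (fun g ε => g (A ε)) = ν.map (fun g ε => g (A ε)) := by
      have hm : Measurable fun (g : Measure X) ε => g (A ε) :=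
        measurable_pi_lambda _ fun ε => Measure.measurable_coe (hA ε)
      refine measure_pi_ext fun T hT => ?_
      rw [Measure.map_apply hm (MeasurableSet.univ_pi hT),
        Measure.map_apply hm (MeasurableSet.univ_pi hT)]
      have : (fun (g : Measure X) ε => g (A ε)) ⁻¹' Set.univ.pi T = {g | ∀ ε, g (A ε) ∈ T ε} := by
        ext g; simp
      rw [this]
      exact h _ A hA hd hU hBA T hT
    have hsum : ∀ s : I, ∀ g : Measure X, g s.1 =
        ∑ ε with (ε s).down = true, g (A ε) := by
      intro s g
      rw [← measure_biUnion_finset (fun ε _ ε' _ hne => hd ε ε' hne) fun ε _ => hA ε]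
      congr 1
      ext x
      simp only [Finset.mem_filter, Finset.mem_univ, true_and, Set.mem_iUnion, exists_prop]
      exact ⟨fun hx => ⟨_, by simpa using hx, hmem x⟩, fun ⟨ε, hε, hx⟩ => (hx s).2 hε⟩
    let T : Set ((I → ULift.{u} Bool) → ℝ≥0∞) :=
      {v | ∀ s : I, s.1 ∈ t → ∑ ε with (ε s).down = true, v ε ∈ S s.1}
    have hT : MeasurableSet T := by
      have : T = ⋂ s : I, ⋂ (_ : s.1 ∈ t),
          (fun v : (I → ULift.{u} Bool) → ℝ≥0∞ => ∑ ε with (ε s).down = true, v ε) ⁻¹' S s.1 := by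
        ext v; simp [T]
      rw [this]
      exact MeasurableSet.iInter fun s => MeasurableSet.iInter fun _ =>
        (Finset.measurable_sum _ fun ε _ => measurable_pi_apply ε) (hS _)
    have hset : (⋂ x ∈ t, f x) = (fun (g : Measure X) ε => g (A ε)) ⁻¹' T := by
      ext g
      simp only [Set.mem_iInter, Set.mem_preimage, T, Set.mem_ofPred_eq]
      constructor
      · intro hg s hs
        have := hg s.1 hs
        rw [hfS _ hs] at this
        rw [← hsum s g]
        exact this
      · intro hg s hs
        rw [hfS _ hs]
        have := hg ⟨s, Finset.mem_insert_of_mem hs⟩ hs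
        rw [← hsum ⟨s, _⟩ g] at this
        exact this
    have hm : Measurable fun (g : Measure X) ε => g (A ε) :=
      measurable_pi_lambda _ fun ε => Measure.measurable_coe (hA ε)
    rw [hset, ← Measure.map_apply hm hT, hmap, Measure.map_apply hm hT]
  -- Equality of total masses, obtained from a trivial partition with no constraint on the masses.
  · by_cases hne : B = Set.univ
    · have := h PUnit (fun _ => Set.univ) (fun _ => .univ) (fun i j hij => absurd rfl hij)
        (by simp [Set.iUnion_const]) (fun _ => Or.inl hne.ge) (fun _ => Set.univ) fun _ => .univ
      simpa using this
    · have := h (ULift Bool) (fun b => if b.down then B else Bᶜ)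
        (fun b => by split_ifs; exacts [hB, hB.compl]) (by
          rintro ⟨_ | _⟩ ⟨_ | _⟩ hij
          · exact absurd rfl hij
          · simpa using disjoint_compl_left
          · simpa using disjoint_compl_right
          · exact absurd rfl hij)
        (Set.eq_univ_of_forall fun x => Set.mem_iUnion.2 (by
          by_cases hx : x ∈ B
          · exact ⟨⟨true⟩, by simpa⟩
          · exact ⟨⟨false⟩, by simpa⟩))
        (by
          rintro ⟨_ | _⟩
          · right; simpa using disjoint_compl_left
          · left; simp) (fun _ => Set.univ) fun _ => .univ
      simpa using this

/-! ### Gamma processes -/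

@[fun_prop]
lemma measurable_measure_eval {T : Type*} [MeasurableSpace T] {f : T → Measure X}
    (hf : Measurable f) {A : Set X} (hA : MeasurableSet A) : Measurable fun t => f t A :=
  (Measure.measurable_coe hA).comp hf

/-- The kernel `g ↦ g`, truncated to `0` when `g` is infinite. -/
noncomputable def massKernel (X : Type*) [MeasurableSpace X] : Kernel (Measure X) X where
  toFun g := open Classical in if g Set.univ < ∞ then g else 0
  measurable' := Measurable.ite
    (measurableSet_lt (Measure.measurable_coe .univ) measurable_const) measurable_id
    measurable_const

lemma massKernel_apply {g : Measure X} (hg : g Set.univ < ∞) : massKernel X g = g := by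
  simp [massKernel, hg]

lemma massKernel_apply_of_infinite {g : Measure X} (hg : ¬ g Set.univ < ∞) :
    massKernel X g = 0 := by
  simp [massKernel, hg]

instance isFiniteMeasure_massKernel (g : Measure X) : IsFiniteMeasure (massKernel X g) := by
  by_cases hg : g Set.univ < ∞
  · rw [massKernel_apply hg]; exact ⟨hg⟩
  · rw [massKernel_apply_of_infinite hg]; infer_instance

/-- The masses are finite but need not be uniformly bounded. Slicing the parameter space by the
integer part of the mass writes the kernel as a countable sum of finite kernels. -/
lemma isSFiniteKernel_of_isFiniteMeasure {S T : Type*} [MeasurableSpace S] [MeasurableSpace T]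
    (η : Kernel S T) [∀ s, IsFiniteMeasure (η s)] : IsSFiniteKernel η := by
  classical
  let κ : ℕ → Kernel S T := fun n =>
    { toFun := fun s => if ⌊(η s Set.univ).toReal⌋₊ = n then η s else 0
      measurable' := by
        refine Measurable.ite ?_ η.measurable measurable_const
        have : Measurable fun s => ⌊(η s Set.univ).toReal⌋₊ :=
          Nat.measurable_floor.comp (η.measurable_coe .univ).ennreal_toReal
        exact this (measurableSet_singleton n) }
  have hκ : ∀ n s, κ n s = if ⌊(η s Set.univ).toReal⌋₊ = n then η s else 0 :=
    fun _ _ => rfl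
  refine ⟨⟨κ, fun n => ⟨⟨ENNReal.ofReal (n + 1), ENNReal.ofReal_lt_top, fun s => ?_⟩⟩, ?_⟩⟩
  · rw [hκ]
    split_ifs with h
    · rw [← ENNReal.ofReal_toReal (measure_ne_top (η s) Set.univ)]
      refine ENNReal.ofReal_le_ofReal ?_
      rw [← h]
      exact (Nat.lt_floor_add_one _).le
    · simp
  · ext s A hA
    rw [Kernel.sum_apply, Measure.sum_apply _ hA, tsum_eq_single ⌊(η s Set.univ).toReal⌋₊]
    · rw [hκ, if_pos rfl]
    · intro n hn
      rw [hκ, if_neg hn.symm]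
      rfl

instance isSFiniteKernel_massKernel : IsSFiniteKernel (massKernel X) :=
  isSFiniteKernel_of_isFiniteMeasure _

/-- The measure `g + w δ_y`. -/
noncomputable def addAtom (g : Measure X) (y : X) (w : ℝ) : Measure X :=
  g + ENNReal.ofReal w • Measure.dirac y

@[fun_prop]
lemma measurable_addAtom {T : Type*} [MeasurableSpace T] {g : T → Measure X} {y : T → X}
    {w : T → ℝ} (hg : Measurable g) (hy : Measurable y) (hw : Measurable w) :
    Measurable fun t => addAtom (g t) (y t) (w t) := by
  refine Measure.measurable_of_measurable_coe _ fun s hs => ?_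
  simp only [addAtom, Measure.add_apply, Measure.smul_apply, Measure.dirac_apply' _ hs,
    smul_eq_mul]
  exact (measurable_measure_eval hg hs).add
    (hw.ennreal_ofReal.mul ((measurable_one.indicator hs).comp hy))

namespace IsGammaProcessLaw

variable {α τ : ℝ} {H : Measure X} {γ : Measure (Measure X)}

lemma lintegral_eval (hγ : IsGammaProcessLaw α τ H γ) {A : Set X} (hA : MeasurableSet A)
    {f : ℝ≥0∞ → ℝ≥0∞} (hf : Measurable f) :
    ∫⁻ g, f (g A) ∂γ = ∫⁻ x, f (ENNReal.ofReal x) ∂gammaLaw (α * H.real A) τ := by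
  rw [← lintegral_map hf (Measure.measurable_coe hA), hγ.marginal A hA,
    lintegral_map hf ENNReal.measurable_ofReal]

lemma lintegral_prod_eval (hγ : IsGammaProcessLaw α τ H γ) {ι : Type*} [Fintype ι]
    {A : ι → Set X} (hA : ∀ i, MeasurableSet (A i)) (hd : ∀ i j, i ≠ j → Disjoint (A i) (A j))
    {f : ι → ℝ≥0∞ → ℝ≥0∞} (hf : ∀ i, Measurable (f i)) :
    ∫⁻ g, ∏ i, f i (g (A i)) ∂γ =
      ∏ i, ∫⁻ x, f i (ENNReal.ofReal x) ∂gammaLaw (α * H.real (A i)) τ := by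
  let e := (Fintype.equivFin ι).symm
  simp_rw [← e.prod_comp]
  have h := (hγ.indep _ (fun k => A (e k)) (fun k => hA _)
    fun i j hij => hd _ _ (e.injective.ne hij)).comp (fun k => f (e k)) fun k => hf _
  have h2 := lintegral_prod_eq_prod_lintegral_of_indepFun Finset.univ _ h
    fun k => (hf _).comp (Measure.measurable_coe (hA _))
  simp only [Function.comp_apply] at h2
  rw [h2]
  exact Finset.prod_congr rfl fun k _ => hγ.lintegral_eval (hA _) (hf _)

lemma ae_lt_top (hγ : IsGammaProcessLaw α τ H γ) : ∀ᵐ g ∂γ, g Set.univ < ∞ := by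
  have h : ∀ᵐ x ∂γ.map (fun g => g Set.univ), x < ∞ := by
    rw [hγ.marginal _ .univ, ae_map_iff ENNReal.measurable_ofReal.aemeasurable measurableSet_Iio]
    exact ae_of_all _ fun x => ENNReal.ofReal_lt_top
  exact ae_of_ae_map (Measure.measurable_coe .univ).aemeasurable h

lemma ae_eq_zero (hγ : IsGammaProcessLaw α τ H γ) {A : Set X} (hA : MeasurableSet A)
    (hHA : H A = 0) : ∀ᵐ g ∂γ, g A = 0 := by
  have h : ∀ᵐ x ∂γ.map (fun g => g A), x = 0 := by
    rw [hγ.marginal _ hA, Measure.real, hHA, ENNReal.toReal_zero, mul_zero, gammaLaw_zero,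
      Measure.map_dirac' ENNReal.measurable_ofReal, ENNReal.ofReal_zero,
      ae_dirac_iff (p := fun x : ℝ≥0∞ => x = 0) (measurableSet_singleton 0)]
  exact ae_of_ae_map (Measure.measurable_coe hA).aemeasurable h

/-- The size-biasing constant `α H(A) / τ` is linear in `H(A)`; this is what lets the cell masses
reassemble into an integral against `H` in the Mecke formula. -/
lemma lintegral_size_bias (hα : 0 < α) (hτ : 0 < τ) [IsProbabilityMeasure H]
    (A : Set X) {f : ℝ≥0∞ → ℝ≥0∞} (hf : Measurable f) :
    ∫⁻ x, ENNReal.ofReal x * f (ENNReal.ofReal x) ∂gammaLaw (α * H.real A) τ =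
      ENNReal.ofReal (α / τ) * H A *
        ∫⁻ x, ∫⁻ w, f (ENNReal.ofReal x + ENNReal.ofReal w) ∂expMeasure τ
          ∂gammaLaw (α * H.real A) τ := by
  have ha : 0 ≤ α * H.real A := by positivity
  rw [lintegral_ofReal_mul_gammaLaw ha hτ (f := fun x => f (ENNReal.ofReal x))
    (hf.comp ENNReal.measurable_ofReal), mul_div_right_comm,
    ENNReal.ofReal_mul (by positivity), Measure.real, ENNReal.ofReal_toReal (measure_ne_top _ _)]
  congr 1
  refine lintegral_congr_ae ?_
  filter_upwards [ae_nonneg_gammaLaw _ τ] with x hx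
  refine lintegral_congr_ae ?_
  rw [expMeasure_eq_gammaLaw]
  filter_upwards [ae_nonneg_gammaLaw _ τ] with w hw
  rw [ENNReal.ofReal_add hx hw]

/-- By independence of the cells, the factor `g (A j)` size-biases the mass of the cell `A j` alone,
which adds an independent exponential to it. An exponential atom at any `y ∈ A j` has exactly the
same effect on the cell masses. -/
lemma lintegral_eval_mul_partition (hγ : IsGammaProcessLaw α τ H γ) (hα : 0 < α) (hτ : 0 < τ)
    [IsProbabilityMeasure H] {ι : Type*} [Fintype ι] [DecidableEq ι]
    {A : ι → Set X} (hA : ∀ i, MeasurableSet (A i)) (hd : ∀ i j, i ≠ j → Disjoint (A i) (A j))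
    {f : ι → ℝ≥0∞ → ℝ≥0∞} (hf : ∀ i, Measurable (f i)) (j : ι) :
    ∫⁻ g, g (A j) * ∏ i, f i (g (A i)) ∂γ =
      ENNReal.ofReal (α / τ) * ∫⁻ g, ∫⁻ y in A j, ∫⁻ w, ∏ i, f i (addAtom g y w (A i))
        ∂expMeasure τ ∂H ∂γ := by
  have := hγ.isProbabilityMeasure
  let F : ι → ℝ≥0∞ → ℝ≥0∞ := fun i x => if i = j then x * f i x else f i x
  let F' : ι → ℝ≥0∞ → ℝ≥0∞ := fun i x =>
    if i = j then ∫⁻ w, f i (x + ENNReal.ofReal w) ∂expMeasure τ else f i x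
  have hF : ∀ i, Measurable (F i) := fun i => by
    by_cases hi : i = j
    · simp only [F, if_pos hi]; exact measurable_id.mul (hf i)
    · simp only [F, if_neg hi]; exact hf i
  have hm : ∀ i, Measurable fun p : ℝ≥0∞ × ℝ => f i (p.1 + ENNReal.ofReal p.2) := fun i => by
    have := hf i
    fun_prop
  have hF' : ∀ i, Measurable (F' i) := fun i => by
    by_cases hi : i = j
    · simp only [F', if_pos hi]
      exact (hm i).lintegral_prod_right'
    · simp only [F', if_neg hi]; exact hf i
  have h1 : ∀ g : Measure X, g (A j) * ∏ i, f i (g (A i)) = ∏ i, F i (g (A i)) := by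
    intro g
    rw [← Finset.mul_prod_erase _ _ (Finset.mem_univ j),
      ← Finset.mul_prod_erase _ _ (Finset.mem_univ j), ← mul_assoc]
    simp only [F, if_true]
    congr 1
    exact Finset.prod_congr rfl fun i hi => by rw [if_neg (Finset.ne_of_mem_erase hi)]
  have h2 : ∀ g : Measure X, ∫⁻ y in A j, ∫⁻ w, ∏ i, f i (addAtom g y w (A i)) ∂expMeasure τ ∂H =
      H (A j) * ∏ i, F' i (g (A i)) := by
    intro g
    rw [mul_comm, ← setLIntegral_const]
    refine setLIntegral_congr_fun (hA j) fun y hy => ?_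
    rw [← Finset.mul_prod_erase _ _ (Finset.mem_univ j)]
    have h3 : ∀ w, ∏ i, f i (addAtom g y w (A i)) =
        f j (g (A j) + ENNReal.ofReal w) * ∏ i ∈ Finset.univ.erase j, f i (g (A i)) := by
      intro w
      rw [← Finset.mul_prod_erase _ _ (Finset.mem_univ j)]
      congr 1
      · simp [addAtom, Measure.dirac_apply' _ (hA j), hy]
      · refine Finset.prod_congr rfl fun i hi => ?_
        have : y ∉ A i := fun hyi =>
          Set.disjoint_left.1 (hd _ _ (Finset.ne_of_mem_erase hi)) hyi hy
        simp [addAtom, Measure.dirac_apply' _ (hA i), this]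
    simp_rw [h3]
    have hm' : Measurable fun w => f j (g (A j) + ENNReal.ofReal w) :=
      (hm j).comp measurable_prodMk_left
    rw [lintegral_mul_const _ hm']
    simp only [F', if_true]
    congr 1
    exact Finset.prod_congr rfl fun i hi => by rw [if_neg (Finset.ne_of_mem_erase hi)]
  simp_rw [h1, h2]
  have hm' : Measurable fun g : Measure X => ∏ i, F' i (g (A i)) :=
    Finset.measurable_prod _ fun i _ => (hF' i).comp (Measure.measurable_coe (hA i))
  rw [lintegral_const_mul _ hm',
    hγ.lintegral_prod_eval hA hd hF, hγ.lintegral_prod_eval hA hd hF',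
    ← Finset.mul_prod_erase _ _ (Finset.mem_univ j),
    ← Finset.mul_prod_erase Finset.univ (fun i => ∫⁻ x, F' i (ENNReal.ofReal x) ∂_)
      (Finset.mem_univ j)]
  simp only [F, F', if_true]
  rw [lintegral_size_bias hα hτ (A j) (hf j)]
  simp_rw [mul_assoc]
  congr 3
  exact Finset.prod_congr rfl fun i hi => by simp_rw [if_neg (Finset.ne_of_mem_erase hi)]

/-- The **Mecke formula** for the gamma process. -/
theorem mecke (hγ : IsGammaProcessLaw α τ H γ) (hα : 0 < α) (hτ : 0 < τ)
    [IsProbabilityMeasure H] {f : Measure X × X → ℝ≥0∞} (hf : Measurable f) :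
    ∫⁻ g, ∫⁻ y, f (g, y) ∂massKernel X g ∂γ =
      ENNReal.ofReal (α / τ) * ∫⁻ g, ∫⁻ y, ∫⁻ w, f (addAtom g y w, y) ∂expMeasure τ ∂H ∂γ := by
  classical
  have := hγ.isProbabilityMeasure
  have : IsProbabilityMeasure (expMeasure τ) := isProbabilityMeasure_expMeasure hτ
  let φ : Measure X × X × ℝ → Measure X × X := fun p => (addAtom p.1 p.2.1 p.2.2, p.2.1)
  have hφ : Measurable φ := by fun_prop
  let μ₁ : Measure (Measure X × X) := γ ⊗ₘ massKernel X
  let μ₂ : Measure (Measure X × X) :=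
    ENNReal.ofReal (α / τ) • (γ.prod (H.prod (expMeasure τ))).map φ
  have hμ₁ : ∀ {f : Measure X × X → ℝ≥0∞}, Measurable f →
      ∫⁻ p, f p ∂μ₁ = ∫⁻ g, ∫⁻ y, f (g, y) ∂massKernel X g ∂γ :=
    fun hf => Measure.lintegral_compProd hf
  have hμ₂ : ∀ {f : Measure X × X → ℝ≥0∞}, Measurable f → ∫⁻ p, f p ∂μ₂ =
      ENNReal.ofReal (α / τ) * ∫⁻ g, ∫⁻ y, ∫⁻ w, f (addAtom g y w, y) ∂expMeasure τ ∂H ∂γ := by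
    intro f hf
    have hfφ : Measurable fun p => f (φ p) := hf.comp hφ
    rw [lintegral_smul_measure, lintegral_map hf hφ, lintegral_prod _ hfφ.aemeasurable,
      smul_eq_mul]
    congr 1
    refine lintegral_congr fun g => ?_
    rw [lintegral_prod]
    exact (hfφ.comp measurable_prodMk_left).aemeasurable
  -- The extensionality arguments need one side to be finite. This is immediate for `μ₂`, whence the
  -- direction `μ₂ = μ₁` below.
  have : IsFiniteMeasure μ₂ := by
    have := Measure.isProbabilityMeasure_map (μ := γ.prod (H.prod (expMeasure τ)))
      hφ.aemeasurable
    exact Measure.smul_finite _ ENNReal.ofReal_ne_top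
  suffices h : μ₂ = μ₁ by rw [← hμ₁ hf, ← hμ₂ hf, h]
  refine Measure.ext_prod fun {C B} hC hB => ?_
  have hcoe : ∀ (μ : Measure (Measure X × X)) {C : Set (Measure X)}, MeasurableSet C →
      μ (C ×ˢ B) = (μ.restrict (Set.univ ×ˢ B)).map Prod.fst C := by
    intro μ C hC
    rw [Measure.map_apply measurable_fst hC,
      Measure.restrict_apply (measurable_fst hC)]
    congr 1
    ext p
    simp
  rw [hcoe _ hC, hcoe _ hC]
  congr 1
  refine measure_ext_of_partition hB fun ι _ A hA hd hU hAB S hS => ?_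
  have hCm : MeasurableSet {g : Measure X | ∀ i, g (A i) ∈ S i} := by
    have : {g : Measure X | ∀ i, g (A i) ∈ S i} = ⋂ i, (fun g : Measure X => g (A i)) ⁻¹' S i := by
      ext g; simp
    rw [this]
    exact MeasurableSet.iInter fun i => Measure.measurable_coe (hA i) (hS i)
  rw [← hcoe _ hCm, ← hcoe _ hCm, ← lintegral_indicator_one (hCm.prod hB),
    ← lintegral_indicator_one (hCm.prod hB), hμ₁ (measurable_one.indicator (hCm.prod hB)),
    hμ₂ (measurable_one.indicator (hCm.prod hB))]
  let F : ι → ℝ≥0∞ → ℝ≥0∞ := fun i => (S i).indicator 1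
  have hF : ∀ i, Measurable (F i) := fun i => measurable_one.indicator (hS i)
  have hind : ∀ (g : Measure X) (y : X),
      ({g : Measure X | ∀ i, g (A i) ∈ S i} ×ˢ B).indicator (1 : Measure X × X → ℝ≥0∞) (g, y) =
      B.indicator (fun _ => ∏ i, F i (g (A i))) y := by
    intro g y
    by_cases hy : y ∈ B
    · rw [Set.indicator_of_mem hy]
      by_cases hg : ∀ i, g (A i) ∈ S i
      · rw [Set.indicator_of_mem (by exact ⟨hg, hy⟩)]
        exact (Finset.prod_eq_one fun i _ => by simp [F, hg i]).symm
      · rw [Set.indicator_of_notMem (by exact fun h => hg h.1)]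
        obtain ⟨i, hi⟩ := not_forall.1 hg
        exact (Finset.prod_eq_zero (Finset.mem_univ i) (by simp [F, hi])).symm
    · rw [Set.indicator_of_notMem hy, Set.indicator_of_notMem (by exact fun h => hy h.2)]
  -- The partition refines `B`, so restricting the point `y` to `B` amounts to summing the one-cell
  -- identity over the cells inside `B`.
  have hBU : B = ⋃ j ∈ Finset.univ.filter (fun j => A j ⊆ B), A j := by
    ext x
    simp only [Finset.mem_filter, Finset.mem_univ, true_and, Set.mem_iUnion, exists_prop]
    constructor
    · intro hx
      obtain ⟨i, hi⟩ := Set.mem_iUnion.1 (hU ▸ Set.mem_univ x)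
      exact ⟨i, (hAB i).resolve_right fun h => Set.disjoint_left.1 h hi hx, hi⟩
    · rintro ⟨j, hj, hx⟩
      exact hj hx
  have hpd : Set.PairwiseDisjoint ↑(Finset.univ.filter (fun j => A j ⊆ B)) A :=
    fun i _ j _ hij => hd i j hij
  have hFm : Measurable fun g : Measure X => ∏ i, F i (g (A i)) :=
    Finset.measurable_prod _ fun i _ => (hF i).comp (Measure.measurable_coe (hA i))
  have hFm' : Measurable fun p : Measure X × X × ℝ =>
      ∏ i, F i (addAtom p.1 p.2.1 p.2.2 (A i)) :=
    hFm.comp (by fun_prop)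
  simp_rw [hind]
  have hL : ∫⁻ g, ∫⁻ y, B.indicator (fun _ => ∏ i, F i (g (A i))) y ∂massKernel X g ∂γ =
      ∑ j with A j ⊆ B, ∫⁻ g, g (A j) * ∏ i, F i (g (A i)) ∂γ := by
    rw [← lintegral_finsetSum _ fun j _ => (Measure.measurable_coe (hA j)).fun_mul hFm]
    refine lintegral_congr_ae ?_
    filter_upwards [hγ.ae_lt_top] with g hg
    rw [lintegral_indicator hB, setLIntegral_const, massKernel_apply hg, ← Finset.sum_mul,
      mul_comm, ← measure_biUnion_finset hpd fun j _ => hA j, ← hBU]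
  have hR : ∀ g : Measure X, ∫⁻ y, ∫⁻ w, B.indicator (fun _ => ∏ i, F i (addAtom g y w (A i))) y
      ∂expMeasure τ ∂H = ∑ j with A j ⊆ B, ∫⁻ y in A j, ∫⁻ w, ∏ i, F i (addAtom g y w (A i))
      ∂expMeasure τ ∂H := by
    intro g
    rw [← lintegral_biUnion_finset hpd fun j _ => hA j, ← hBU, ← lintegral_indicator hB]
    refine lintegral_congr fun y => ?_
    by_cases hy : y ∈ B <;> simp [hy]
  have hRm : Measurable fun p : Measure X × X =>
      ∫⁻ w, ∏ i, F i (addAtom p.1 p.2 w (A i)) ∂expMeasure τ :=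
    Measurable.lintegral_prod_right' (f := fun p : (Measure X × X) × ℝ =>
      ∏ i, F i (addAtom p.1.1 p.1.2 p.2 (A i)))
      (hFm'.comp (f := fun p : (Measure X × X) × ℝ => (p.1.1, p.1.2, p.2)) (by fun_prop))
  simp_rw [hR]
  rw [hL, lintegral_finsetSum _ fun j _ => hRm.lintegral_prod_right', Finset.mul_sum]
  exact Finset.sum_congr rfl fun j _ =>
    (hγ.lintegral_eval_mul_partition hα hτ hA hd hF j).symm

end IsGammaProcessLaw

/-- Multiplication by a positive constant, as a measurable equivalence of the space of measures. -/
noncomputable def smulMeasureEquiv (X : Type*) [MeasurableSpace X] {c : ℝ} (hc : 0 < c) :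
    Measure X ≃ᵐ Measure X where
  toFun g := ENNReal.ofReal c • g
  invFun g := ENNReal.ofReal c⁻¹ • g
  left_inv g := by
    simp only []
    rw [← mul_smul, ← ENNReal.ofReal_mul (by positivity), inv_mul_cancel₀ hc.ne',
      ENNReal.ofReal_one, one_smul]
  right_inv g := by
    simp only []
    rw [← mul_smul, ← ENNReal.ofReal_mul (by positivity), mul_inv_cancel₀ hc.ne',
      ENNReal.ofReal_one, one_smul]
  measurable_toFun := Measure.measurable_of_measurable_coe _ fun s hs =>
    (Measure.measurable_coe hs).const_mul _
  measurable_invFun := Measure.measurable_of_measurable_coe _ fun s hs =>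
    (Measure.measurable_coe hs).const_mul _

/-! ### Scaling and exponential tilting of the gamma process -/

namespace IsGammaProcessLaw

variable {α τ : ℝ} {H : Measure X} {γ : Measure (Measure X)}

/-- Scaling a gamma process by `c` divides its rate by `c`. -/
lemma map_smul (hγ : IsGammaProcessLaw α τ H γ) (hα : 0 < α) (hτ : 0 < τ) {c : ℝ} (hc : 0 < c) :
    IsGammaProcessLaw α (τ / c) H (γ.map fun g => ENNReal.ofReal c • g) := by
  have := hγ.isProbabilityMeasure
  have hm : Measurable fun g : Measure X => ENNReal.ofReal c • g :=
    (smulMeasureEquiv X hc).measurable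
  have hprob := Measure.isProbabilityMeasure_map (μ := γ) hm.aemeasurable
  have heval : ∀ {A : Set X}, MeasurableSet A → Measurable fun g : Measure X => g A :=
    fun hA => Measure.measurable_coe hA
  have hmul : Measurable fun x : ℝ≥0∞ => ENNReal.ofReal c * x := measurable_id.const_mul _
  have hmarg : ∀ {A : Set X}, MeasurableSet A →
      (γ.map fun g => ENNReal.ofReal c • g).map (fun g => g A) =
        (γ.map fun g => g A).map fun x => ENNReal.ofReal c * x := by
    intro A hA
    rw [Measure.map_map (heval hA) hm, Measure.map_map hmul (heval hA)]
    rfl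
  refine ⟨hprob, ?_, ?_, ?_⟩
  -- Being a countable sum of atoms is not known to be a measurable property of `g`. Since scaling
  -- is a measurable embedding, the almost sure statement transfers all the same.
  · refine (smulMeasureEquiv X hc).measurableEmbedding.ae_map_iff.2 ?_
    filter_upwards [hγ.atomic] with g hg
    obtain ⟨w, x, hw, rfl⟩ := hg
    refine ⟨fun k => c * w k, x, fun k => mul_pos hc (hw k), ?_⟩
    ext s hs
    simp only [smulMeasureEquiv, MeasurableEquiv.coe_mk, Equiv.coe_fn_mk, Measure.smul_apply,
      Measure.sum_apply _ hs, smul_eq_mul, ENNReal.ofReal_mul hc.le, ← ENNReal.tsum_mul_left,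
      mul_assoc]
  · intro n A hA hd
    have h := ((hγ.indep n A hA hd).comp (fun _ x => ENNReal.ofReal c * x) fun _ => hmul)
    rw [iIndepFun_iff_map_fun_eq_pi_map fun i => (hmul.comp (heval (hA i))).aemeasurable] at h
    rw [iIndepFun_iff_map_fun_eq_pi_map fun i => (heval (hA i)).aemeasurable,
      Measure.map_map (measurable_pi_lambda _ fun i => heval (hA i)) hm]
    refine h.trans ?_
    congr 1
    funext i
    rw [hmarg (hA i), Measure.map_map hmul (heval (hA i))]
  · intro A hA
    rw [hmarg hA, hγ.marginal A hA, Measure.map_map hmul ENNReal.measurable_ofReal,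
      ← map_const_mul_gammaLaw (by positivity) hτ hc,
      Measure.map_map ENNReal.measurable_ofReal (by fun_prop)]
    congr 1
    funext x
    simp [ENNReal.ofReal_mul hc.le]

/-- Exponential tilting of the gamma process. -/
theorem lintegral_exp_mul (hγ : IsGammaProcessLaw α τ H γ) (hα : 0 < α) (hτ : 0 < τ)
    [IsProbabilityMeasure H] {z : ℝ} (hz : 0 ≤ z) {f : Measure X → ℝ≥0∞} (hf : Measurable f) :
    ∫⁻ g, ENNReal.ofReal (Real.exp (-(z * (g Set.univ).toReal))) * f g ∂γ =
      ENNReal.ofReal ((τ / (τ + z)) ^ α) *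
        ∫⁻ g, f (ENNReal.ofReal (τ / (τ + z)) • g) ∂γ := by
  have := hγ.isProbabilityMeasure
  have hτz : 0 < τ + z := by positivity
  -- The scale is chosen so that the rate `τ` divided by it is `τ + z`.
  have hc : 0 < τ / (τ + z) := by positivity
  have hm : Measurable fun g : Measure X => ENNReal.ofReal (τ / (τ + z)) • g :=
    (smulMeasureEquiv X hc).measurable
  have hγ' := hγ.map_smul hα hτ hc
  rw [div_div_cancel₀ hτ.ne'] at hγ'
  have he : Measurable fun g : Measure X =>
      ENNReal.ofReal (Real.exp (-(z * (g Set.univ).toReal))) :=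
    (((Measure.measurable_coe .univ).ennreal_toReal.const_mul z).neg.exp).ennreal_ofReal
  have hwd := lintegral_withDensity_eq_lintegral_mul γ he hf
  simp only [Pi.mul_apply] at hwd
  rw [← lintegral_map hf hm, ← smul_eq_mul, ← lintegral_smul_measure, ← hwd]
  congr 1
  have : IsFiniteMeasure (γ.withDensity fun g =>
      ENNReal.ofReal (Real.exp (-(z * (g Set.univ).toReal)))) := by
    refine isFiniteMeasure_withDensity ((lintegral_mono (g := 1) fun g => ?_).trans_lt ?_).ne
    · rw [Pi.one_apply, ENNReal.ofReal_le_one, Real.exp_le_one_iff]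
      have := mul_nonneg hz (ENNReal.toReal_nonneg (a := g Set.univ))
      linarith
    · simp
  refine measure_ext_of_partition .univ fun ι _ A hA hd hU _ S hS => ?_
  have hCm : MeasurableSet {g : Measure X | ∀ i, g (A i) ∈ S i} := by
    have : {g : Measure X | ∀ i, g (A i) ∈ S i} = ⋂ i, (fun g : Measure X => g (A i)) ⁻¹' S i := by
      ext g; simp
    rw [this]
    exact MeasurableSet.iInter fun i => Measure.measurable_coe (hA i) (hS i)
  let F : ι → ℝ≥0∞ → ℝ≥0∞ := fun i => (S i).indicator 1
  have hF : ∀ i, Measurable (F i) := fun i => measurable_one.indicator (hS i)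
  have hind : ∀ g : Measure X, ({g : Measure X | ∀ i, g (A i) ∈ S i}).indicator 1 g =
      ∏ i, F i (g (A i)) := by
    intro g
    by_cases hg : ∀ i, g (A i) ∈ S i
    · rw [Set.indicator_of_mem (by exact hg)]
      exact (Finset.prod_eq_one fun i _ => by simp [F, hg i]).symm
    · rw [Set.indicator_of_notMem (by exact hg)]
      obtain ⟨i, hi⟩ := not_forall.1 hg
      exact (Finset.prod_eq_zero (Finset.mem_univ i) (by simp [F, hi])).symm
  have hFe : ∀ i, Measurable fun x : ℝ≥0∞ =>
      ENNReal.ofReal (Real.exp (-(z * x.toReal))) * F i x := fun i => by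
    have := hF i
    fun_prop
  have hsum : ∀ g : Measure X, g Set.univ = ∑ i, g (A i) := by
    intro g
    rw [← hU, measure_iUnion (fun i j hij => hd i j hij) hA, tsum_fintype]
  rw [← lintegral_indicator_one hCm, ← lintegral_indicator_one hCm, lintegral_smul_measure,
    lintegral_withDensity_eq_lintegral_mul _ he (measurable_one.indicator hCm)]
  simp only [Pi.mul_apply]
  simp_rw [hind]
  rw [hγ'.lintegral_prod_eval hA hd hF]
  have h1 : ∫⁻ g, ENNReal.ofReal (Real.exp (-(z * (g Set.univ).toReal))) * ∏ i, F i (g (A i)) ∂γ =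
      ∫⁻ g, ∏ i, ENNReal.ofReal (Real.exp (-(z * (g (A i)).toReal))) * F i (g (A i)) ∂γ := by
    refine lintegral_congr_ae ?_
    filter_upwards [hγ.ae_lt_top] with g hg
    rw [Finset.prod_mul_distrib, ← ENNReal.ofReal_prod_of_nonneg fun i _ => (Real.exp_pos _).le,
      ← Real.exp_sum, Finset.sum_neg_distrib, ← Finset.mul_sum, hsum g, ENNReal.toReal_sum]
    exact fun i _ => ((measure_mono (Set.subset_univ _)).trans_lt hg).ne
  rw [h1, hγ.lintegral_prod_eval hA hd hFe]
  have h2 : ∀ i, ∫⁻ x, ENNReal.ofReal (Real.exp (-(z * (ENNReal.ofReal x).toReal))) *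
      F i (ENNReal.ofReal x) ∂gammaLaw (α * H.real (A i)) τ =
      ENNReal.ofReal ((τ / (τ + z)) ^ (α * H.real (A i))) *
        ∫⁻ x, F i (ENNReal.ofReal x) ∂gammaLaw (α * H.real (A i)) (τ + z) := by
    intro i
    rw [← lintegral_exp_mul_gammaLaw (by positivity) hτ hz
      (f := fun x => F i (ENNReal.ofReal x)) ((hF i).comp ENNReal.measurable_ofReal)]
    refine lintegral_congr_ae ?_
    filter_upwards [ae_nonneg_gammaLaw _ τ] with x hx
    rw [ENNReal.toReal_ofReal hx]
  simp_rw [h2]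
  rw [Finset.prod_mul_distrib, ← ENNReal.ofReal_prod_of_nonneg fun i _ => by positivity,
    ← Real.rpow_sum_of_pos hc, ← Finset.mul_sum, smul_eq_mul]
  -- The tilting constants of the cells are `(τ / (τ + z)) ^ (α H(Aᵢ))`. Their product is
  -- independent of the partition because `H` has total mass one.
  have h3 : ∑ i, H.real (A i) = 1 := by
    simp only [Measure.real]
    rw [← ENNReal.toReal_sum fun i _ => measure_ne_top _ _, ← hsum H]
    simp
  rw [h3, mul_one]

end IsGammaProcessLaw

/-! ### Products of copies of a random measure -/

/-- The kernel sending a finite measure `g` to its power `g ^ ι`. -/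
noncomputable def massPiKernel (ι X : Type*) [Fintype ι] [MeasurableSpace X] :
    Kernel (Measure X) (ι → X) where
  toFun g := Measure.pi fun _ => massKernel X g
  measurable' := by
    refine Measurable.measure_of_isPiSystem generateFrom_pi.symm isPiSystem_pi ?_ ?_
    · rintro _ ⟨S, hS, rfl⟩
      simp_rw [Measure.pi_pi]
      exact Finset.measurable_prod _ fun i _ => (massKernel X).measurable_coe (hS i trivial)
    · simp_rw [← Set.pi_univ Set.univ, Measure.pi_pi]
      exact Finset.measurable_prod _ fun i _ => (massKernel X).measurable_coe .univ

lemma massPiKernel_apply (ι : Type*) [Fintype ι] (g : Measure X) :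
    massPiKernel ι X g = Measure.pi fun _ => massKernel X g := rfl

instance isFiniteMeasure_massPiKernel (ι : Type*) [Fintype ι] (g : Measure X) :
    IsFiniteMeasure (massPiKernel ι X g) := by
  rw [massPiKernel_apply]; infer_instance

instance isSFiniteKernel_massPiKernel (ι : Type*) [Fintype ι] :
    IsSFiniteKernel (massPiKernel ι X) :=
  isSFiniteKernel_of_isFiniteMeasure _

@[fun_prop]
lemma measurable_fin_cons {T Y : Type*} [MeasurableSpace T] [MeasurableSpace Y] {n : ℕ}
    {x : T → Y} {y : T → Fin n → Y} (hx : Measurable x) (hy : Measurable y) :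
    Measurable fun t => (Fin.cons (x t) (y t) : Fin (n + 1) → Y) := by
  refine measurable_pi_lambda _ fun i => ?_
  refine Fin.cases ?_ (fun i => ?_) i
  · simpa using hx
  · simpa using measurable_pi_iff.1 hy i

lemma lintegral_pi_cons {Y : Type*} [MeasurableSpace Y] {n : ℕ} (μ : Measure Y) [SigmaFinite μ]
    {f : (Fin (n + 1) → Y) → ℝ≥0∞} (hf : Measurable f) :
    ∫⁻ y, f y ∂Measure.pi (fun _ => μ) =
      ∫⁻ y, ∫⁻ x, f (Fin.cons x y) ∂μ ∂Measure.pi (fun _ => μ) := by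
  have hm : Measurable fun p : Y × (Fin n → Y) => f (Fin.cons p.1 p.2) :=
    hf.comp (by fun_prop)
  have h := (measurePreserving_piFinSuccAbove (fun _ : Fin (n + 1) => μ) 0).lintegral_comp hm
  rw [lintegral_prod_symm _ hm.aemeasurable] at h
  rw [← h]
  refine lintegral_congr fun y => congrArg f ?_
  exact (Fin.cons_self_tail y).symm

lemma map_comp_equiv_pi {Y ι ι' : Type*} [MeasurableSpace Y] [Fintype ι] [Fintype ι']
    (e : ι ≃ ι') (μ : Measure Y) [SigmaFinite μ] :
    (Measure.pi fun _ : ι => μ).map (fun y i => y (e.symm i)) = Measure.pi fun _ : ι' => μ := by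
  refine (Measure.pi_eq fun S hS => ?_).symm
  rw [Measure.map_apply (by fun_prop) (MeasurableSet.univ_pi hS), ← e.prod_comp,
    ← Measure.pi_pi]
  congr 1
  ext y
  simp only [Set.mem_preimage, Set.mem_pi, Set.mem_univ, true_implies]
  exact ⟨fun h i => by simpa using h (e i), fun h i => by simpa using h (e.symm i)⟩

lemma lintegral_pi_equiv {Y ι ι' : Type*} [MeasurableSpace Y] [Fintype ι] [Fintype ι']
    (e : ι ≃ ι') (μ : Measure Y) [SigmaFinite μ] {f : (ι' → Y) → ℝ≥0∞} (hf : Measurable f) :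
    ∫⁻ y, f y ∂Measure.pi (fun _ => μ) =
      ∫⁻ y, f (fun i => y (e.symm i)) ∂Measure.pi (fun _ : ι => μ) := by
  rw [← map_comp_equiv_pi e μ, lintegral_map hf (by fun_prop)]

lemma measurable_update_snd {Y ι : Type*} [MeasurableSpace Y] [DecidableEq ι] (q : ι) :
    Measurable fun p : (ι → Y) × Y => Function.update p.1 q p.2 := by
  refine measurable_pi_lambda _ fun i => ?_
  by_cases hi : i = q
  · subst hi; simpa using measurable_snd
  · simp only [Function.update_of_ne hi]
    fun_prop

/-- Resampling one coordinate. -/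
lemma lintegral_pi_update_of_ne {Y ι : Type*} [MeasurableSpace Y] [Fintype ι] [DecidableEq ι]
    (μ ν : ι → Measure Y) [∀ i, IsProbabilityMeasure (μ i)]
    [∀ i, IsProbabilityMeasure (ν i)] (q : ι) (hν : ∀ i ≠ q, ν i = μ i) {f : (ι → Y) → ℝ≥0∞} (hf : Measurable f) :
    ∫⁻ y, f y ∂Measure.pi μ =
      ∫⁻ y, ∫⁻ x, f (Function.update y q x) ∂μ q ∂Measure.pi ν := by
  have hu : Measurable fun p : (ι → Y) × Y => Function.update p.1 q p.2 := measurable_update_snd q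
  have h : ((Measure.pi ν).prod (μ q)).map (fun p : (ι → Y) × Y =>
      Function.update p.1 q p.2) = Measure.pi μ := by
    refine (Measure.pi_eq fun S hS => ?_).symm
    rw [Measure.map_apply hu (MeasurableSet.univ_pi hS)]
    have : (fun p : (ι → Y) × Y => Function.update p.1 q p.2) ⁻¹' Set.univ.pi S =
        (Set.univ.pi (Function.update S q Set.univ)) ×ˢ S q := by
      ext p
      simp only [Set.mem_preimage, Set.mem_pi, Set.mem_univ, true_implies, Set.mem_prod]
      constructor
      · intro h
        refine ⟨fun i => ?_, by simpa using h q⟩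
        by_cases hi : i = q
        · subst hi; simp
        · simpa [hi] using h i
      · rintro ⟨h1, h2⟩ i
        by_cases hi : i = q
        · subst hi; simpa using h2
        · simpa [hi] using h1 i
    rw [this, Measure.prod_prod, Measure.pi_pi, ← Finset.mul_prod_erase _ _ (Finset.mem_univ q),
      ← Finset.mul_prod_erase Finset.univ (fun i => μ i (S i)) (Finset.mem_univ q), mul_comm]
    simp only [Function.update_self, measure_univ, one_mul]
    congr 1
    exact Finset.prod_congr rfl fun i hi => by
      rw [Function.update_of_ne (Finset.ne_of_mem_erase hi), hν i (Finset.ne_of_mem_erase hi)]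
  have hfu : Measurable fun p : (ι → Y) × Y => f (Function.update p.1 q p.2) := hf.comp hu
  rw [← lintegral_prod _ hfu.aemeasurable, ← lintegral_map hf hu, h]

lemma lintegral_pi_update {Y ι : Type*} [MeasurableSpace Y] [Fintype ι] [DecidableEq ι]
    (μ : ι → Measure Y) [∀ i, IsProbabilityMeasure (μ i)] (q : ι) {f : (ι → Y) → ℝ≥0∞}
    (hf : Measurable f) :
    ∫⁻ y, f y ∂Measure.pi μ = ∫⁻ y, ∫⁻ x, f (Function.update y q x) ∂μ q ∂Measure.pi μ :=
  lintegral_pi_update_of_ne μ μ q (fun _ _ => rfl) hf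

lemma ae_nonneg_pi_expMeasure {ι : Type*} [Fintype ι] (τ : ℝ) :
    ∀ᵐ w ∂Measure.pi (fun _ : ι => expMeasure τ), ∀ i, 0 ≤ w i := by
  rw [ae_all_iff]
  intro i
  have h := ae_nonneg_gammaLaw 1 τ
  rw [← expMeasure_eq_gammaLaw] at h
  exact (Measure.quasiMeasurePreserving_eval (fun _ : ι => expMeasure τ) i).ae h

/-- A size-biased `Exp(τ)` variable is the sum of two independent ones, so picking the atom `q` in
proportion to its weight adds a second exponential weight at the same location. -/
lemma lintegral_ofReal_mul_pi_expMeasure {ι : Type*} [Fintype ι] [DecidableEq ι] {τ : ℝ}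
    (hτ : 0 < τ) (q : ι) {f : (ι → ℝ) → ℝ≥0∞} (hf : Measurable f) :
    ∫⁻ w, ENNReal.ofReal (w q) * f w ∂Measure.pi (fun _ => expMeasure τ) =
      ENNReal.ofReal (1 / τ) * ∫⁻ w, ∫⁻ v, f (Function.update w q (w q + v)) ∂expMeasure τ
        ∂Measure.pi (fun _ => expMeasure τ) := by
  have : IsProbabilityMeasure (expMeasure τ) := isProbabilityMeasure_expMeasure hτ
  have hu : Measurable fun p : (ι → ℝ) × ℝ => Function.update p.1 q p.2 := measurable_update_snd q
  have hm : Measurable fun w : ι → ℝ =>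
      ∫⁻ v, f (Function.update w q (w q + v)) ∂expMeasure τ := by
    refine Measurable.lintegral_prod_right'
      (f := fun p : (ι → ℝ) × ℝ => f (Function.update p.1 q (p.1 q + p.2))) ?_
    exact hf.comp (hu.comp (f := fun p : (ι → ℝ) × ℝ => (p.1, p.1 q + p.2)) (by fun_prop))
  have hm2 : Measurable fun w : ι → ℝ => ∫⁻ x, ∫⁻ v, f (Function.update w q (x + v))
      ∂expMeasure τ ∂expMeasure τ := by
    refine Measurable.lintegral_prod_right' (f := fun p : (ι → ℝ) × ℝ =>
      ∫⁻ v, f (Function.update p.1 q (p.2 + v)) ∂expMeasure τ) ?_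
    refine Measurable.lintegral_prod_right' (f := fun p : ((ι → ℝ) × ℝ) × ℝ =>
      f (Function.update p.1.1 q (p.1.2 + p.2))) ?_
    exact hf.comp (hu.comp
      (f := fun p : ((ι → ℝ) × ℝ) × ℝ => (p.1.1, p.1.2 + p.2)) (by fun_prop))
  rw [lintegral_pi_update _ q (by fun_prop), lintegral_pi_update _ q hm]
  simp only [Function.update_self, Function.update_idem]
  rw [← lintegral_const_mul _ hm2]
  refine lintegral_congr fun w => ?_
  rw [expMeasure_eq_gammaLaw, lintegral_ofReal_mul_gammaLaw zero_le_one hτ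
    (f := fun x => f (Function.update w q x)) (hf.comp (hu.comp measurable_prodMk_left)),
    expMeasure_eq_gammaLaw]

/-- The measure `g + ∑ᵢ wᵢ δ_{yᵢ}`. -/
noncomputable def addAtoms {ι : Type*} [Fintype ι] (g : Measure X) (y : ι → X) (w : ι → ℝ) :
    Measure X :=
  g + ∑ i, ENNReal.ofReal (w i) • Measure.dirac (y i)

lemma addAtoms_apply {ι : Type*} [Fintype ι] (g : Measure X) (y : ι → X) (w : ι → ℝ) {A : Set X}
    (hA : MeasurableSet A) :
    addAtoms g y w A = g A + ∑ i, ENNReal.ofReal (w i) * A.indicator 1 (y i) := by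
  simp [addAtoms, Measure.add_apply, Measure.dirac_apply' _ hA]

@[fun_prop]
lemma measurable_addAtoms {ι T : Type*} [Fintype ι] [MeasurableSpace T] {g : T → Measure X}
    {y : T → ι → X} {w : T → ι → ℝ} (hg : Measurable g) (hy : Measurable y) (hw : Measurable w) :
    Measurable fun t => addAtoms (g t) (y t) (w t) := by
  refine Measure.measurable_of_measurable_coe _ fun s hs => ?_
  simp only [addAtoms_apply _ _ _ hs]
  refine (measurable_measure_eval hg hs).add (Finset.measurable_sum _ fun i _ => ?_)
  exact (measurable_pi_iff.1 hw i).ennreal_ofReal.mul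
    ((measurable_one.indicator hs).comp (measurable_pi_iff.1 hy i))

lemma addAtoms_cons {n : ℕ} (g : Measure X) (x : X) (y : Fin n → X) (v : ℝ) (w : Fin n → ℝ) :
    addAtoms g (Fin.cons x y : Fin (n + 1) → X) (Fin.cons v w : Fin (n + 1) → ℝ) =
      addAtoms (addAtom g x v) y w := by
  simp [addAtoms, addAtom, Fin.sum_univ_succ, add_assoc]

lemma addAtoms_update {ι : Type*} [Fintype ι] [DecidableEq ι] (g : Measure X) (y : ι → X)
    {w : ι → ℝ} {v : ℝ} {q : ι} (hw : 0 ≤ w q) (hv : 0 ≤ v) :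
    addAtoms g y (Function.update w q (w q + v)) = addAtoms (addAtom g (y q) v) y w := by
  simp only [addAtoms, addAtom]
  rw [← Finset.add_sum_erase _ _ (Finset.mem_univ q),
    ← Finset.add_sum_erase Finset.univ (fun i => ENNReal.ofReal (w i) • Measure.dirac (y i))
      (Finset.mem_univ q), Function.update_self, ENNReal.ofReal_add hw hv, add_smul]
  have : ∀ i ∈ Finset.univ.erase q, ENNReal.ofReal (Function.update w q (w q + v) i) •
      Measure.dirac (y i) = ENNReal.ofReal (w i) • Measure.dirac (y i) := fun i hi => by
    rw [Function.update_of_ne (Finset.ne_of_mem_erase hi)]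
  rw [Finset.sum_congr rfl this]
  abel

lemma addAtoms_univ_lt_top {ι : Type*} [Fintype ι] {g : Measure X} (hg : g Set.univ < ∞)
    (y : ι → X) (w : ι → ℝ) : addAtoms g y w Set.univ < ∞ := by
  rw [addAtoms_apply _ _ _ .univ]
  simpa using hg

lemma lintegral_addAtoms {ι : Type*} [Fintype ι] (g : Measure X) (y : ι → X) (w : ι → ℝ)
    {f : X → ℝ≥0∞} (hf : Measurable f) :
    ∫⁻ x, f x ∂addAtoms g y w = ∫⁻ x, f x ∂g + ∑ i, ENNReal.ofReal (w i) * f (y i) := by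
  rw [addAtoms, lintegral_add_measure, lintegral_finsetSum_measure]
  simp only [lintegral_smul_measure, smul_eq_mul, lintegral_dirac' _ hf]

/-! ### The iterated Mecke formula -/

namespace IsGammaProcessLaw

variable {α τ : ℝ} {H : Measure X} {γ : Measure (Measure X)}

/-- One step of the urn. A point drawn from `g + ∑ w_q δ_{y_q}` comes either from `g`, and Mecke's
formula then yields a fresh location from `H`, or from an atom, and size-biasing then repeats the
location `y_q`. Both cases create one more independent `Exp(τ)` weight, so the shape of the formula
is preserved even with repeated locations. -/
lemma mecke_cons (hγ : IsGammaProcessLaw α τ H γ) (hα : 0 < α) (hτ : 0 < τ)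
    [IsProbabilityMeasure H] {n : ℕ} (y : Fin n → X)
    {f : Measure X × X → ℝ≥0∞} (hf : Measurable f) :
    ∫⁻ g, ∫⁻ w, ∫⁻ x, f (addAtoms g y w, x) ∂massKernel X (addAtoms g y w)
      ∂Measure.pi (fun _ => expMeasure τ) ∂γ =
    ENNReal.ofReal (α / τ) * ∫⁻ x, ∫⁻ g, ∫⁻ w, f (addAtoms g (Fin.cons x y : Fin (n + 1) → X) w, x)
      ∂Measure.pi (fun _ => expMeasure τ) ∂γ ∂H +
    ∑ q, ENNReal.ofReal (1 / τ) * ∫⁻ g, ∫⁻ w,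
      f (addAtoms g (Fin.cons (y q) y : Fin (n + 1) → X) w, y q)
      ∂Measure.pi (fun _ => expMeasure τ) ∂γ := by
  have := hγ.isProbabilityMeasure
  have : IsProbabilityMeasure (expMeasure τ) := isProbabilityMeasure_expMeasure hτ
  have hsplit : ∀ᵐ g ∂γ, ∀ w : Fin n → ℝ,
      ∫⁻ x, f (addAtoms g y w, x) ∂massKernel X (addAtoms g y w) =
      ∫⁻ x, f (addAtoms g y w, x) ∂massKernel X g +
        ∑ q, ENNReal.ofReal (w q) * f (addAtoms g y w, y q) := by
    filter_upwards [hγ.ae_lt_top] with g hg w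
    rw [massKernel_apply (addAtoms_univ_lt_top hg y w), massKernel_apply hg]
    exact lintegral_addAtoms g y w (f := fun x => f (addAtoms g y w, x))
      (hf.comp measurable_prodMk_left)
  have hm1 : Measurable fun p : Measure X × (Fin n → ℝ) =>
      ∫⁻ x, f (addAtoms p.1 y p.2, x) ∂massKernel X p.1 := by
    refine Measurable.lintegral_kernel_prod_right'
      (κ := (massKernel X).comap (Prod.fst : Measure X × (Fin n → ℝ) → Measure X) measurable_fst)
      (f := fun p : (Measure X × (Fin n → ℝ)) × X => f (addAtoms p.1.1 y p.1.2, p.2)) ?_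
    fun_prop
  have hm2 : ∀ q, Measurable fun p : Measure X × (Fin n → ℝ) =>
      ENNReal.ofReal (p.2 q) * f (addAtoms p.1 y p.2, y q) := fun q => by fun_prop
  have h1 : ∫⁻ g, ∫⁻ w, ∫⁻ x, f (addAtoms g y w, x) ∂massKernel X (addAtoms g y w)
      ∂Measure.pi (fun _ => expMeasure τ) ∂γ =
      ∫⁻ g, (∫⁻ w, ∫⁻ x, f (addAtoms g y w, x) ∂massKernel X g
        ∂Measure.pi (fun _ => expMeasure τ) +
        ∑ q, ∫⁻ w, ENNReal.ofReal (w q) * f (addAtoms g y w, y q)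
          ∂Measure.pi (fun _ => expMeasure τ)) ∂γ := by
    refine lintegral_congr_ae ?_
    filter_upwards [hsplit] with g hg
    simp_rw [hg]
    have hm1' : Measurable fun w => ∫⁻ x, f (addAtoms g y w, x) ∂massKernel X g :=
      hm1.comp measurable_prodMk_left
    rw [lintegral_add_left hm1', lintegral_finsetSum]
    exact fun q _ => (hm2 q).comp measurable_prodMk_left
  rw [h1, lintegral_add_left hm1.lintegral_prod_right',
    lintegral_finsetSum _ fun q _ => (hm2 q).lintegral_prod_right']
  congr 1
  · have hm4 : Measurable fun p : ((Fin n → ℝ) × Measure X) × X × ℝ =>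
        f (addAtoms (addAtom p.1.2 p.2.1 p.2.2) y p.1.1, p.2.1) := by fun_prop
    -- The old weights `w` are frozen so that Mecke's formula can be applied to `g`. The new weight
    -- `v` then joins them as the coordinate `0`.
    rw [lintegral_lintegral_swap hm1.aemeasurable]
    have h2 : ∀ w : Fin n → ℝ, ∫⁻ g, ∫⁻ x, f (addAtoms g y w, x) ∂massKernel X g ∂γ =
        ENNReal.ofReal (α / τ) * ∫⁻ g, ∫⁻ x, ∫⁻ v, f (addAtoms (addAtom g x v) y w, x)
          ∂expMeasure τ ∂H ∂γ := fun w =>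
      hγ.mecke hα hτ (f := fun p => f (addAtoms p.1 y w, p.2)) (by fun_prop)
    simp_rw [h2]
    have hm5 : Measurable fun p : ((Fin n → ℝ) × Measure X) × X =>
        ∫⁻ v, f (addAtoms (addAtom p.1.2 p.2 v) y p.1.1, p.2) ∂expMeasure τ :=
      Measurable.lintegral_prod_right' (f := fun p : (((Fin n → ℝ) × Measure X) × X) × ℝ =>
        f (addAtoms (addAtom p.1.1.2 p.1.2 p.2) y p.1.1.1, p.1.2)) (by fun_prop)
    have hm6 : Measurable fun p : (Fin n → ℝ) × Measure X =>
        ∫⁻ x, ∫⁻ v, f (addAtoms (addAtom p.2 x v) y p.1, x) ∂expMeasure τ ∂H :=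
      hm5.lintegral_prod_right'
    rw [lintegral_const_mul _ hm6.lintegral_prod_right']
    congr 1
    rw [lintegral_lintegral_swap hm6.aemeasurable]
    have hm7 : Measurable fun p : Measure X × X => ∫⁻ w, ∫⁻ v,
        f (addAtoms (addAtom p.1 p.2 v) y w, p.2) ∂expMeasure τ
        ∂Measure.pi (fun _ => expMeasure τ) :=
      Measurable.lintegral_prod_right' (f := fun p : (Measure X × X) × (Fin n → ℝ) =>
        ∫⁻ v, f (addAtoms (addAtom p.1.1 p.1.2 v) y p.2, p.1.2) ∂expMeasure τ)
        (hm5.comp (f := fun p : (Measure X × X) × (Fin n → ℝ) => ((p.2, p.1.1), p.1.2))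
          (by fun_prop))
    have h3 : ∀ g : Measure X, ∫⁻ w, ∫⁻ x, ∫⁻ v, f (addAtoms (addAtom g x v) y w, x)
        ∂expMeasure τ ∂H ∂Measure.pi (fun _ => expMeasure τ) =
        ∫⁻ x, ∫⁻ w, ∫⁻ v, f (addAtoms (addAtom g x v) y w, x) ∂expMeasure τ
        ∂Measure.pi (fun _ => expMeasure τ) ∂H := fun g =>
      lintegral_lintegral_swap (hm5.comp (f := fun p : (Fin n → ℝ) × X => ((p.1, g), p.2))
        (by fun_prop)).aemeasurable
    simp_rw [h3]
    rw [lintegral_lintegral_swap hm7.aemeasurable]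
    refine lintegral_congr fun x => lintegral_congr fun g => ?_
    rw [lintegral_pi_cons _ (by fun_prop)]
    simp_rw [addAtoms_cons]
  · refine Finset.sum_congr rfl fun q _ => ?_
    have hm9 : Measurable fun p : Measure X × (Fin (n + 1) → ℝ) =>
        f (addAtoms p.1 (Fin.cons (y q) y : Fin (n + 1) → X) p.2, y q) := by fun_prop
    rw [← lintegral_const_mul _ hm9.lintegral_prod_right']
    refine lintegral_congr fun g => ?_
    rw [lintegral_pi_cons _ (by fun_prop)]
    simp_rw [addAtoms_cons]
    rw [lintegral_ofReal_mul_pi_expMeasure hτ q (f := fun w => f (addAtoms g y w, y q))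
      (by fun_prop)]
    congr 1
    refine lintegral_congr_ae ?_
    filter_upwards [ae_nonneg_pi_expMeasure τ] with w hw
    refine lintegral_congr_ae ?_
    have := ae_nonneg_gammaLaw 1 τ
    rw [← expMeasure_eq_gammaLaw] at this
    filter_upwards [this] with v hv
    rw [addAtoms_update g y (hw q) hv]

/-- The iterated Mecke formula: integrating over the power `g ^ n` of a gamma process amounts to
drawing the points from a fixed measure, and adding independent exponential atoms there. -/
lemma exists_mecke_fin (hγ : IsGammaProcessLaw α τ H γ) (hα : 0 < α) (hτ : 0 < τ)
    [IsProbabilityMeasure H] (n : ℕ) :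
    ∃ Λ : Measure (Fin n → X), IsFiniteMeasure Λ ∧
      ∀ f : Measure X × (Fin n → X) → ℝ≥0∞, Measurable f →
        ∫⁻ g, ∫⁻ y, f (g, y) ∂massPiKernel (Fin n) X g ∂γ =
          ∫⁻ y, ∫⁻ g, ∫⁻ w, f (addAtoms g y w, y) ∂Measure.pi (fun _ => expMeasure τ) ∂γ ∂Λ := by
  have := hγ.isProbabilityMeasure
  have : IsProbabilityMeasure (expMeasure τ) := isProbabilityMeasure_expMeasure hτ
  induction n with
  | zero =>
    refine ⟨Measure.dirac isEmptyElim, inferInstance, fun f hf => ?_⟩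
    simp only [massPiKernel_apply]
    have hm : Measurable fun p : ((Fin 0 → X) × Measure X) × (Fin 0 → ℝ) =>
        f (addAtoms p.1.2 p.1.1 p.2, p.1.1) := by fun_prop
    rw [lintegral_dirac' _ (hm.lintegral_prod_right').lintegral_prod_right']
    refine lintegral_congr fun g => ?_
    rw [Measure.pi_of_empty _ isEmptyElim, Measure.pi_of_empty _ isEmptyElim,
      lintegral_dirac' _ (by fun_prop), lintegral_dirac' _ (by fun_prop)]
    simp [addAtoms]
  | succ n ih =>
    obtain ⟨Λ, hΛ, ih⟩ := ih
    have hc0 : Measurable fun p : X × (Fin n → X) => (Fin.cons p.1 p.2 : Fin (n + 1) → X) := by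
      fun_prop
    have hcq : ∀ q, Measurable fun y : Fin n → X => (Fin.cons (y q) y : Fin (n + 1) → X) := by
      intro q
      fun_prop
    -- The unnormalised urn: a new location with weight `α / τ`, or a copy of each earlier one with
    -- weight `1 / τ`.
    let Λ' : Measure (Fin (n + 1) → X) :=
      ENNReal.ofReal (α / τ) • (H.prod Λ).map (fun p => (Fin.cons p.1 p.2 : Fin (n + 1) → X)) +
        ∑ q, ENNReal.ofReal (1 / τ) • Λ.map fun y => (Fin.cons (y q) y : Fin (n + 1) → X)
    refine ⟨Λ', ?_, fun f hf => ?_⟩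
    · have h1 := Measure.smul_finite
        ((H.prod Λ).map (fun p => (Fin.cons p.1 p.2 : Fin (n + 1) → X)))
        (ENNReal.ofReal_ne_top (r := α / τ))
      have h2 : ∀ q, IsFiniteMeasure (ENNReal.ofReal (1 / τ) •
          Λ.map fun y => (Fin.cons (y q) y : Fin (n + 1) → X)) := fun q =>
        Measure.smul_finite _ ENNReal.ofReal_ne_top
      infer_instance
    · let F : (Fin (n + 1) → X) → ℝ≥0∞ := fun y =>
        ∫⁻ g, ∫⁻ w, f (addAtoms g y w, y) ∂Measure.pi (fun _ => expMeasure τ) ∂γ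
      have hm : Measurable fun p : ((Fin (n + 1) → X) × Measure X) × (Fin (n + 1) → ℝ) =>
          f (addAtoms p.1.2 p.1.1 p.2, p.1.1) := by fun_prop
      have hF : Measurable F := (hm.lintegral_prod_right').lintegral_prod_right'
      have hF0 : Measurable fun p : X × (Fin n → X) => F (Fin.cons p.1 p.2) := hF.comp hc0
      have hFq : ∀ q, Measurable fun y : Fin n → X => F (Fin.cons (y q) y) :=
        fun q => hF.comp (hcq q)
      have hR : ∫⁻ y, F y ∂Λ' = ∫⁻ y, (ENNReal.ofReal (α / τ) * ∫⁻ x, F (Fin.cons x y) ∂H +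
          ∑ q, ENNReal.ofReal (1 / τ) * F (Fin.cons (y q) y)) ∂Λ := by
        rw [lintegral_add_measure, lintegral_finsetSum_measure, lintegral_smul_measure,
          lintegral_map hF hc0, lintegral_prod_symm' _ hF0,
          lintegral_add_left (hF0.lintegral_prod_left'.const_mul _),
          lintegral_const_mul _ hF0.lintegral_prod_left', lintegral_finsetSum _ fun q _ =>
            (hFq q).const_mul _, smul_eq_mul]
        congr 1
        refine Finset.sum_congr rfl fun q _ => ?_
        rw [lintegral_smul_measure, lintegral_map hF (hcq q), smul_eq_mul,
          lintegral_const_mul _ (hFq q)]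
      rw [show ∫⁻ y, ∫⁻ g, ∫⁻ w, f (addAtoms g y w, y)
        ∂Measure.pi (fun _ => expMeasure τ) ∂γ ∂Λ' = ∫⁻ y, F y ∂Λ' from rfl, hR]
      -- The newest point is integrated out first: the induction hypothesis handles the other `n`
      -- points, and `mecke_cons` then handles this one under `g` with its `n` added atoms.
      let f' : Measure X × (Fin n → X) → ℝ≥0∞ := fun p =>
        ∫⁻ x, f (p.1, Fin.cons x p.2) ∂massKernel X p.1
      have hf' : Measurable f' := by
        refine Measurable.lintegral_kernel_prod_right'
          (κ := (massKernel X).comap (Prod.fst : Measure X × (Fin n → X) → Measure X)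
            measurable_fst)
          (f := fun p : (Measure X × (Fin n → X)) × X => f (p.1.1, Fin.cons p.2 p.1.2)) ?_
        fun_prop
      have hL : ∫⁻ g, ∫⁻ y, f (g, y) ∂massPiKernel (Fin (n + 1)) X g ∂γ =
          ∫⁻ g, ∫⁻ y, f' (g, y) ∂massPiKernel (Fin n) X g ∂γ := by
        refine lintegral_congr fun g => ?_
        rw [massPiKernel_apply, lintegral_pi_cons _ (by fun_prop), massPiKernel_apply]
      rw [hL, ih f' hf']
      refine lintegral_congr fun y => ?_
      exact hγ.mecke_cons hα hτ y (f := fun p => f (p.1, Fin.cons p.2 y)) (by fun_prop)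

lemma exists_mecke (hγ : IsGammaProcessLaw α τ H γ) (hα : 0 < α) (hτ : 0 < τ)
    [IsProbabilityMeasure H] (ι : Type*) [Fintype ι] :
    ∃ Λ : Measure (ι → X), IsFiniteMeasure Λ ∧
      ∀ f : Measure X × (ι → X) → ℝ≥0∞, Measurable f →
        ∫⁻ g, ∫⁻ y, f (g, y) ∂massPiKernel ι X g ∂γ =
          ∫⁻ y, ∫⁻ g, ∫⁻ w, f (addAtoms g y w, y) ∂Measure.pi (fun _ => expMeasure τ) ∂γ ∂Λ := by
  have := hγ.isProbabilityMeasure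
  have : IsProbabilityMeasure (expMeasure τ) := isProbabilityMeasure_expMeasure hτ
  let e := (Fintype.equivFin ι).symm
  obtain ⟨Λ, hΛ, h⟩ := hγ.exists_mecke_fin hα hτ (Fintype.card ι)
  have he : Measurable fun (y : Fin (Fintype.card ι) → X) i => y (e.symm i) := by fun_prop
  refine ⟨Λ.map fun y i => y (e.symm i), inferInstance, fun f hf => ?_⟩
  have hm : Measurable fun p : ((ι → X) × Measure X) × (ι → ℝ) =>
      f (addAtoms p.1.2 p.1.1 p.2, p.1.1) := by fun_prop
  rw [lintegral_map (hm.lintegral_prod_right').lintegral_prod_right' he]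
  have hL : ∫⁻ g, ∫⁻ y, f (g, y) ∂massPiKernel ι X g ∂γ =
      ∫⁻ g, ∫⁻ y, f (g, fun i => y (e.symm i)) ∂massPiKernel (Fin (Fintype.card ι)) X g ∂γ := by
    refine lintegral_congr fun g => ?_
    rw [massPiKernel_apply, lintegral_pi_equiv e _ (by fun_prop), massPiKernel_apply]
  rw [hL, h (fun p => f (p.1, fun i => p.2 (e.symm i))) (by fun_prop)]
  refine lintegral_congr fun y => lintegral_congr fun g => ?_
  rw [lintegral_pi_equiv e _ (by fun_prop)]
  refine lintegral_congr fun w => ?_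
  congr 2
  simp only [addAtoms]
  rw [← e.sum_comp]
  simp

end IsGammaProcessLaw

/-! ### The density of the data -/

lemma map_uncurry_pi {Y ι ι' : Type*} [MeasurableSpace Y] [Fintype ι] [Fintype ι']
    (μ : Measure Y) [SigmaFinite μ] :
    (Measure.pi fun _ : ι => Measure.pi fun _ : ι' => μ).map (fun y (p : ι × ι') => y p.1 p.2) =
      Measure.pi fun _ : ι × ι' => μ := by
  have hm : Measurable fun (y : ι → ι' → Y) (p : ι × ι') => y p.1 p.2 :=
    measurable_pi_lambda _ fun p => by fun_prop
  refine (Measure.pi_eq fun S hS => ?_).symm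
  rw [Measure.map_apply hm (MeasurableSet.univ_pi hS)]
  have : (fun (y : ι → ι' → Y) (p : ι × ι') => y p.1 p.2) ⁻¹' Set.univ.pi S =
      Set.univ.pi fun l => Set.univ.pi fun i => S (l, i) := by
    ext y
    simp
  rw [this, Measure.pi_pi]
  simp_rw [Measure.pi_pi]
  rw [← Finset.univ_product_univ, Finset.prod_product]

lemma map_curry_pi {Y ι ι' : Type*} [MeasurableSpace Y] [Fintype ι] [Fintype ι']
    (μ : Measure Y) [SigmaFinite μ] :
    (Measure.pi fun _ : ι × ι' => μ).map (fun y l i => y (l, i)) =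
      Measure.pi fun _ : ι => Measure.pi fun _ : ι' => μ := by
  have hm : Measurable fun (y : ι → ι' → Y) (p : ι × ι') => y p.1 p.2 :=
    measurable_pi_lambda _ fun p => by fun_prop
  have hm' : Measurable fun (y : ι × ι' → Y) (l : ι) (i : ι') => y (l, i) :=
    measurable_pi_lambda _ fun l => measurable_pi_lambda _ fun i => by fun_prop
  rw [← map_uncurry_pi, Measure.map_map hm' hm]
  exact Measure.map_id

/-- Assemble a data set from all its items and all its times. -/
def assemble {L m : ℕ} (y : Fin L × Fin m → X) (z : Fin L × Fin m → ℝ) : RankingData X L m :=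
  fun l => (fun i => y (l, i), fun i => z (l, i))

@[fun_prop]
lemma measurable_assemble {T : Type*} [MeasurableSpace T] {L m : ℕ} {y : T → Fin L × Fin m → X}
    {z : T → Fin L × Fin m → ℝ} (hy : Measurable y) (hz : Measurable z) :
    Measurable fun t => assemble (y t) (z t) := by
  refine measurable_pi_lambda _ fun l => ?_
  exact (measurable_pi_lambda _ fun i => measurable_pi_iff.1 hy (l, i)).prodMk
    (measurable_pi_lambda _ fun i => measurable_pi_iff.1 hz (l, i))

lemma map_assemble {L m : ℕ} (μ : Measure X) (ν : Measure ℝ) [SigmaFinite μ] [SigmaFinite ν] :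
    ((Measure.pi fun _ : Fin L × Fin m => μ).prod (Measure.pi fun _ : Fin L × Fin m => ν)).map
      (fun p => assemble p.1 p.2) =
    Measure.pi fun _ : Fin L =>
      (Measure.pi fun _ : Fin m => μ).prod (Measure.pi fun _ : Fin m => ν) := by
  have h := (measurePreserving_arrowProdEquivProdArrow (Fin m → X) (Fin m → ℝ) (Fin L)
    (fun _ => Measure.pi fun _ => μ) (fun _ => Measure.pi fun _ => ν)).symm
  rw [← h.map_eq, ← map_curry_pi μ, ← map_curry_pi ν, Measure.map_prod_map _ _
    (measurable_pi_lambda _ fun l => measurable_pi_lambda _ fun i => by fun_prop)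
    (measurable_pi_lambda _ fun l => measurable_pi_lambda _ fun i => by fun_prop),
    Measure.map_map (MeasurableEquiv.measurable _)]
  · rfl
  · refine (measurable_pi_lambda _ fun l => measurable_pi_lambda _ fun i => ?_).prodMk
      (measurable_pi_lambda _ fun l => measurable_pi_lambda _ fun i => ?_)
    · exact (measurable_pi_apply (l, i)).comp measurable_fst
    · exact (measurable_pi_apply (l, i)).comp measurable_snd

/-- Lebesgue measure on the half-line `[0, ∞)`. -/
noncomputable def halfLine : Measure ℝ := volume.restrict (Set.Ici 0)

instance sigmaFinite_halfLine : SigmaFinite halfLine := by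
  unfold halfLine; infer_instance

lemma expMeasure_eq_withDensity (r : ℝ) :
    expMeasure r = halfLine.withDensity fun z => ENNReal.ofReal (r * Real.exp (-(z * r))) := by
  rw [halfLine, ← withDensity_indicator measurableSet_Ici, expMeasure, gammaMeasure]
  congr 1
  funext z
  by_cases hz : 0 ≤ z
  · rw [Set.indicator_of_mem (by exact hz), gammaPDF_of_nonneg hz]
    simp [mul_comm r z]
  · rw [Set.indicator_of_notMem (by exact hz), gammaPDF_of_neg (not_le.1 hz)]

/-- The density of a ranking and its times, with respect to the `m`-th power of `g` times Lebesgue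
measure. -/
noncomputable def rankingDensity {X : Type*} [MeasurableSpace X] {m : ℕ} (g : Measure X)
    (y : Fin m → X) (z : Fin m → ℝ) : ℝ≥0∞ :=
  {y : Fin m → X | Function.Injective y}.indicator 1 y *
    ENNReal.ofReal (Real.exp (-∑ i, z i * (massKernel X g (remaining y i)).toReal))

lemma rankingDensity_ne_top {m : ℕ} (g : Measure X) (y : Fin m → X) (z : Fin m → ℝ) :
    rankingDensity g y z ≠ ∞ := by
  refine ENNReal.mul_ne_top ?_ ENNReal.ofReal_ne_top
  by_cases hy : Function.Injective y <;> simp [hy]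

section Density

variable [MeasurableEq X]

/-- Each condition `y j ≠ x` is the complement of a preimage of the diagonal, which is measurable by
assumption. -/
lemma measurableSet_remaining_graph {m : ℕ} (i : Fin m) :
    MeasurableSet {p : (Fin m → X) × X | p.2 ∈ remaining p.1 i} := by
  have : {p : (Fin m → X) × X | p.2 ∈ remaining p.1 i} =
      ⋂ j, ⋂ (_ : j < i), {p : (Fin m → X) × X | p.1 j = p.2}ᶜ := by
    ext p; simp [remaining]
  rw [this]
  refine MeasurableSet.iInter fun j => MeasurableSet.iInter fun _ =>
    (measurableSet_eq_fun ?_ measurable_snd).compl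
  fun_prop

lemma measurableSet_remaining {m : ℕ} (y : Fin m → X) (i : Fin m) :
    MeasurableSet (remaining y i) :=
  (measurableSet_remaining_graph i).preimage (measurable_prodMk_left (x := y))

lemma measurable_remainingMass {m : ℕ} (i : Fin m) :
    Measurable fun p : Measure X × (Fin m → X) => massKernel X p.1 (remaining p.2 i) := by
  have h := Kernel.measurable_kernel_prodMk_left
    (κ := (massKernel X).comap (Prod.fst : Measure X × (Fin m → X) → Measure X) measurable_fst)
    ((measurableSet_remaining_graph i).preimage
      (f := fun q : (Measure X × (Fin m → X)) × X => (q.1.2, q.2)) (by fun_prop))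
  exact h

lemma measurableSet_injective {m : ℕ} : MeasurableSet {y : Fin m → X | Function.Injective y} := by
  have : {y : Fin m → X | Function.Injective y} =
      ⋂ i, ⋂ j, ⋂ (_ : i ≠ j), {y : Fin m → X | y i = y j}ᶜ := by
    ext y
    simp only [Set.mem_ofPred_eq, Set.mem_iInter, Set.mem_compl_iff]
    exact ⟨fun h i j hij hy => hij (h hy), fun h i j hy => by
      by_contra hij
      exact h i j hij hy⟩
  rw [this]
  exact MeasurableSet.iInter fun i => MeasurableSet.iInter fun j => MeasurableSet.iInter fun _ =>
    (measurableSet_eq_fun (measurable_pi_apply i) (measurable_pi_apply j)).compl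

@[fun_prop]
lemma measurable_rankingDensity {T : Type*} [MeasurableSpace T] {m : ℕ} {g : T → Measure X}
    {y : T → Fin m → X} {z : T → Fin m → ℝ} (hg : Measurable g) (hy : Measurable y)
    (hz : Measurable z) : Measurable fun t => rankingDensity (g t) (y t) (z t) := by
  refine ((measurable_one.indicator measurableSet_injective).comp hy).mul ?_
  refine (Measurable.neg (Finset.measurable_sum _ fun i _ => ?_)).exp.ennreal_ofReal
  exact (measurable_pi_iff.1 hz i).mul
    ((measurable_remainingMass i).comp (hg.prodMk hy)).ennreal_toReal

/-- The power of `g` is carried by the countable set of lists with entries in `S`, where the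
integral is a sum. All other lists have weight zero, so the sum may run over all lists, as it does
in `rankingLaw`. -/
lemma lintegral_pi_of_countable_support {ι : Type*} [Fintype ι] (g : Measure X) [IsFiniteMeasure g]
    {S : Set X} (hS : S.Countable) (hg : g Sᶜ = 0) (f : (ι → X) → ℝ≥0∞) :
    ∫⁻ y, f y ∂Measure.pi (fun _ => g) = ∑' y : ι → X, (∏ i, g {y i}) * f y := by
  have hSc : (Set.univ.pi fun _ : ι => S).Countable := Set.countable_univ_pi fun _ => hS
  have hmem : ∀ᵐ y ∂Measure.pi (fun _ : ι => g), y ∈ Set.univ.pi fun _ : ι => S := by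
    have : ∀ᵐ y ∂Measure.pi (fun _ : ι => g), ∀ i, y i ∈ S := by
      rw [ae_all_iff]
      intro i
      exact (Measure.quasiMeasurePreserving_eval (fun _ : ι => g) i).ae (p := fun x => x ∈ S)
        (by rwa [ae_iff])
    filter_upwards [this] with y hy i _ using hy i
  rw [← Measure.restrict_eq_self_of_ae_mem hmem, lintegral_countable _ hSc]
  simp_rw [Measure.pi_singleton]
  rw [tsum_subtype (Set.univ.pi fun _ : ι => S) fun y => f y * ∏ i, g {y i}]
  refine tsum_congr fun y => ?_
  by_cases hy : y ∈ Set.univ.pi fun _ : ι => S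
  · rw [Set.indicator_of_mem hy, mul_comm]
  · rw [Set.indicator_of_notMem hy]
    simp only [Set.mem_pi, Set.mem_univ, true_implies, not_forall] at hy
    obtain ⟨i, hi⟩ := hy
    have : g {y i} = 0 := measure_mono_null (by simpa using hi) hg
    rw [Finset.prod_eq_zero (Finset.mem_univ i) this, zero_mul]

/-- The key cancellation: the product of the exponential rates is exactly the product of the
Plackett–Luce denominators. -/
lemma plackettLuceProb_mul_interArrivalLaw {m : ℕ} (g : Measure X) [IsFiniteMeasure g]
    (y : Fin m → X) {B : Set (Fin m → ℝ)} (hB : MeasurableSet B) :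
    plackettLuceProb g y * interArrivalLaw g y B =
      (∏ i, g {y i}) * ∫⁻ z in B, rankingDensity g y z ∂Measure.pi fun _ => halfLine := by
  by_cases hy : Function.Injective y
  swap
  · simp [plackettLuceProb, rankingDensity, hy]
  rw [plackettLuceProb, if_pos hy]
  by_cases h0 : ∃ i, g {y i} = 0
  · obtain ⟨i, hi⟩ := h0
    have h1 : ∏ i, g {y i} = 0 := Finset.prod_eq_zero (Finset.mem_univ i) hi
    have h2 : ∏ i, g {y i} / g (remaining y i) = 0 :=
      Finset.prod_eq_zero (Finset.mem_univ i) (by rw [hi, ENNReal.zero_div])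
    rw [h1, h2, zero_mul, zero_mul]
  push Not at h0
  -- The items being distinct, `y i` itself is still available at stage `i`, so its positive mass
  -- bounds the denominator from below.
  have hpos : ∀ i, g (remaining y i) ≠ 0 := fun i h =>
    h0 i (measure_mono_null (by
      rw [Set.singleton_subset_iff]
      exact fun j hj h => hj.ne (hy h)) h)
  have hr : ∀ i, 0 < (g (remaining y i)).toReal := fun i =>
    ENNReal.toReal_pos (hpos i) (measure_ne_top _ _)
  have hm : ∀ i, Measurable fun z : ℝ => ENNReal.ofReal ((g (remaining y i)).toReal *
      Real.exp (-(z * (g (remaining y i)).toReal))) := fun i => by fun_prop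
  have hσ : ∀ i, SigmaFinite (halfLine.withDensity fun z : ℝ =>
      ENNReal.ofReal ((g (remaining y i)).toReal *
        Real.exp (-(z * (g (remaining y i)).toReal)))) := fun i => by
    rw [← expMeasure_eq_withDensity]; infer_instance
  have hlaw : interArrivalLaw g y = (Measure.pi fun _ => halfLine).withDensity fun z =>
      ∏ i, ENNReal.ofReal ((g (remaining y i)).toReal *
        Real.exp (-(z i * (g (remaining y i)).toReal))) := by
    rw [interArrivalLaw, ← pi_withDensity (fun _ => halfLine) hm]
    congr 1
    funext i
    exact expMeasure_eq_withDensity _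
  have hprod : ∀ z : Fin m → ℝ, ∏ i, ENNReal.ofReal ((g (remaining y i)).toReal *
        Real.exp (-(z i * (g (remaining y i)).toReal))) =
      (∏ i, g (remaining y i)) * rankingDensity g y z := by
    intro z
    rw [rankingDensity, Set.indicator_of_mem (by exact hy), Pi.one_apply, one_mul,
      ← Finset.sum_neg_distrib, Real.exp_sum,
      ENNReal.ofReal_prod_of_nonneg fun i _ => (Real.exp_pos _).le, ← Finset.prod_mul_distrib]
    refine Finset.prod_congr rfl fun i _ => ?_
    rw [ENNReal.ofReal_mul ENNReal.toReal_nonneg, ENNReal.ofReal_toReal (measure_ne_top _ _),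
      massKernel_apply (measure_lt_top g _)]
  rw [hlaw, withDensity_apply _ hB]
  simp_rw [hprod]
  rw [lintegral_const_mul _ (by fun_prop), ← mul_assoc, ← Finset.prod_mul_distrib]
  congr 1
  exact Finset.prod_congr rfl fun i _ => ENNReal.div_mul_cancel (hpos i) (measure_ne_top _ _)

instance sigmaFinite_interArrivalLaw {m : ℕ} (g : Measure X) (y : Fin m → X) :
    SigmaFinite (interArrivalLaw g y) := by
  unfold interArrivalLaw; infer_instance

lemma rankingLaw_eq_withDensity {m : ℕ} (g : Measure X) [IsFiniteMeasure g]
    {S : Set X} (hS : S.Countable) (hg : g Sᶜ = 0) :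
    rankingLaw m g = ((Measure.pi fun _ => g).prod (Measure.pi fun _ => halfLine)).withDensity
      fun p => rankingDensity g p.1 p.2 := by
  have hρ : Measurable fun p : (Fin m → X) × (Fin m → ℝ) => rankingDensity g p.1 p.2 := by
    fun_prop
  ext A hA
  have hAy : ∀ y : Fin m → X, MeasurableSet (Prod.mk y ⁻¹' A) := fun y =>
    measurable_prodMk_left hA
  rw [rankingLaw, Measure.sum_apply _ hA, withDensity_apply _ hA, ← lintegral_indicator hA,
    lintegral_prod _ (hρ.indicator hA).aemeasurable, lintegral_pi_of_countable_support g hS hg]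
  refine tsum_congr fun y => ?_
  rw [Measure.smul_apply, Measure.dirac_prod, Measure.map_apply measurable_prodMk_left hA,
    smul_eq_mul, plackettLuceProb_mul_interArrivalLaw g y (hAy y), ← lintegral_indicator (hAy y)]
  rfl

/-- The density of a data set. -/
noncomputable def dataDensity {X : Type*} [MeasurableSpace X] {L m : ℕ} (g : Measure X)
    (d : RankingData X L m) : ℝ≥0∞ :=
  ∏ l, rankingDensity g (d l).1 (d l).2

@[fun_prop]
lemma measurable_dataDensity {T : Type*} [MeasurableSpace T] {L m : ℕ} {g : T → Measure X}
    {d : T → RankingData X L m} (hg : Measurable g) (hd : Measurable d) :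
    Measurable fun t => dataDensity (g t) (d t) :=
  Finset.measurable_prod _ fun l _ => measurable_rankingDensity hg
    (measurable_pi_iff.1 hd l).fst (measurable_pi_iff.1 hd l).snd

lemma lintegral_dataLaw {L m : ℕ} (g : Measure X) [IsFiniteMeasure g]
    {S : Set X} (hS : S.Countable) (hg : g Sᶜ = 0) {f : RankingData X L m → ℝ≥0∞}
    (hf : Measurable f) :
    ∫⁻ d, f d ∂dataLaw L m g = ∫⁻ y, ∫⁻ z, dataDensity g (assemble y z) * f (assemble y z)
      ∂Measure.pi (fun _ => halfLine) ∂Measure.pi fun _ => g := by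
  have hρ : Measurable fun p : (Fin m → X) × (Fin m → ℝ) => rankingDensity g p.1 p.2 := by
    fun_prop
  have hσ : SigmaFinite (((Measure.pi fun _ : Fin m => g).prod
      (Measure.pi fun _ : Fin m => halfLine)).withDensity fun p => rankingDensity g p.1 p.2) :=
    SigmaFinite.withDensity_of_ne_top (ae_of_all _ fun p => rankingDensity_ne_top _ _ _)
  have hd : Measurable fun d : RankingData X L m => dataDensity g d := by fun_prop
  have ha : Measurable fun p : (Fin L × Fin m → X) × (Fin L × Fin m → ℝ) =>
      assemble p.1 p.2 := by fun_prop
  have hdf : Measurable fun d : RankingData X L m => dataDensity g d * f d := hd.mul hf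
  have hdfa : Measurable fun p : (Fin L × Fin m → X) × (Fin L × Fin m → ℝ) =>
      dataDensity g (assemble p.1 p.2) * f (assemble p.1 p.2) := hdf.comp ha
  rw [dataLaw]
  simp_rw [rankingLaw_eq_withDensity g hS hg]
  rw [pi_withDensity (fun _ : Fin L => (Measure.pi fun _ : Fin m => g).prod
    (Measure.pi fun _ : Fin m => halfLine)) fun _ => hρ]
  change ∫⁻ d, f d ∂Measure.withDensity _ (fun d => dataDensity g d) = _
  rw [lintegral_withDensity_eq_lintegral_mul _ hd hf, ← map_assemble]
  change ∫⁻ d, (dataDensity g d * f d) ∂_ = _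
  rw [lintegral_map hdf ha, lintegral_prod _ hdfa.aemeasurable]

end Density

end

/-! ### Sums of exponential variables over blocks -/

lemma isProbabilityMeasure_gammaLaw_natCast {τ : ℝ} (hτ : 0 < τ) (n : ℕ) :
    IsProbabilityMeasure (gammaLaw n τ) :=
  isProbabilityMeasure_gammaLaw n.cast_nonneg hτ

/-- The exponentials are added one at a time: each goes to a single block and raises the shape of
that block by one. Blocks start at the point mass at `0`, the convention for shape `0`. -/
lemma lintegral_block_sum_fin {K : Type*} [Fintype K] [DecidableEq K] {τ : ℝ} (hτ : 0 < τ) {n : ℕ}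
    (y : Fin n → K) {f : (K → ℝ) → ℝ≥0∞}
    (hf : Measurable f) :
    ∫⁻ w, f (fun x => ∑ p with y p = x, w p) ∂Measure.pi (fun _ => expMeasure τ) =
      ∫⁻ v, f v ∂Measure.pi fun x => gammaLaw (Finset.univ.filter fun p => y p = x).card τ := by
  have hp := isProbabilityMeasure_gammaLaw_natCast hτ
  have : IsProbabilityMeasure (expMeasure τ) := isProbabilityMeasure_expMeasure hτ
  induction n generalizing f with
  | zero =>
    have h0 : (Measure.pi fun _ : K => Measure.dirac (0 : ℝ)) = Measure.dirac fun _ => 0 := by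
      refine Measure.pi_eq fun S hS => ?_
      rw [Measure.dirac_apply' _ (MeasurableSet.univ_pi hS)]
      simp_rw [Measure.dirac_apply' _ (hS _)]
      by_cases h : ∀ x, (0 : ℝ) ∈ S x
      · rw [Set.indicator_of_mem (by exact fun x _ => h x)]
        exact (Finset.prod_eq_one fun x _ => Set.indicator_of_mem (h x) _).symm
      · rw [Set.indicator_of_notMem (by exact fun h' => h fun x => h' x trivial)]
        obtain ⟨x, hx⟩ := not_forall.1 h
        exact (Finset.prod_eq_zero (Finset.mem_univ x) (Set.indicator_of_notMem hx _)).symm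
    simp only [Finset.univ_eq_empty, Finset.filter_empty, Finset.sum_empty, Finset.card_empty,
      Nat.cast_zero, gammaLaw_zero, h0]
    rw [lintegral_const, measure_univ, mul_one, lintegral_dirac' _ hf]
  | succ n ih =>
    have hm : Measurable fun w : Fin (n + 1) → ℝ => f (fun x => ∑ p with y p = x, w p) :=
      hf.comp (measurable_pi_lambda _ fun x => Finset.measurable_sum _ fun p _ =>
        measurable_pi_apply p)
    have hu := measurable_update_snd (Y := ℝ) (y 0)
    have hm0 : Measurable fun v : K → ℝ =>
        ∫⁻ b, f (Function.update v (y 0) (v (y 0) + b)) ∂expMeasure τ := by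
      refine Measurable.lintegral_prod_right' (f := fun p : (K → ℝ) × ℝ =>
        f (Function.update p.1 (y 0) (p.1 (y 0) + p.2))) ?_
      exact hf.comp (hu.comp (f := fun p : (K → ℝ) × ℝ => (p.1, p.1 (y 0) + p.2)) (by fun_prop))
    have hsum : ∀ (b : ℝ) (w : Fin n → ℝ),
        (fun x => ∑ p with y p = x, (Fin.cons b w : Fin (n + 1) → ℝ) p) =
          Function.update (fun x => ∑ p with y p.succ = x, w p) (y 0)
            ((fun x => ∑ p with y p.succ = x, w p) (y 0) + b) := by
      intro b w
      funext x
      rw [Finset.sum_filter, Fin.sum_univ_succ]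
      simp only [Fin.cons_zero, Fin.cons_succ, ← Finset.sum_filter]
      by_cases hx : x = y 0
      · subst hx; simp [add_comm]
      · rw [Function.update_of_ne hx, if_neg (Ne.symm hx), zero_add]
    rw [lintegral_pi_cons _ hm]
    simp_rw [hsum]
    have hcard : ∀ x, (Finset.univ.filter fun p => y p = x).card =
        (if y 0 = x then 1 else 0) + (Finset.univ.filter fun p : Fin n => y p.succ = x).card := by
      intro x
      rw [Finset.card_filter, Fin.sum_univ_succ, Finset.card_filter]
    -- Only the law of coordinate `y 0` differs between the two products, so both are written by
    -- resampling that coordinate over a common product measure.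
    rw [ih (fun p => y p.succ) hm0, lintegral_pi_update _ (y 0) hm0,
      lintegral_pi_update_of_ne _
        (fun x => gammaLaw (Finset.univ.filter fun p : Fin n => y p.succ = x).card τ) (y 0)
        (fun x hx => by rw [hcard, if_neg (Ne.symm hx), zero_add]) hf]
    simp only [Function.update_self, Function.update_idem]
    have hc0 : ((Finset.univ.filter fun p => y p = y 0).card : ℝ) =
        (Finset.univ.filter fun p : Fin n => y p.succ = y 0).card + 1 := by
      rw [hcard, if_pos rfl]; push_cast; ring
    have hfu : ∀ v : K → ℝ, Measurable fun b => f (Function.update v (y 0) b) := fun v =>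
      hf.comp (hu.comp measurable_prodMk_left)
    simp_rw [fun v : K → ℝ => lintegral_gammaLaw_add_exp
      (a := (Finset.univ.filter fun p : Fin n => y p.succ = y 0).card) (by positivity) hτ (hfu v)]
    rw [hc0]

lemma map_block_sum {K ι : Type*} [Fintype K] [DecidableEq K] [Fintype ι] {τ : ℝ} (hτ : 0 < τ)
    (y : ι → K) :
    (Measure.pi fun _ : ι => expMeasure τ).map (fun w x => ∑ p with y p = x, w p) =
      Measure.pi fun x => gammaLaw (Finset.univ.filter fun p => y p = x).card τ := by
  have hm : Measurable fun (w : ι → ℝ) (x : K) => ∑ p with y p = x, w p :=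
    measurable_pi_lambda _ fun x => Finset.measurable_sum _ fun p _ => measurable_pi_apply p
  let e := (Fintype.equivFin ι).symm
  refine Measure.ext_of_lintegral _ fun f hf => ?_
  rw [lintegral_map hf hm, lintegral_pi_equiv e (expMeasure τ) (f := fun w => f fun x => ∑ p with y p = x, w p)
    (hf.comp hm)]
  have hcard : ∀ x, (Finset.univ.filter fun p => y p = x).card =
      (Finset.univ.filter fun k => y (e k) = x).card := by
    intro x
    rw [Finset.card_filter, Finset.card_filter, ← e.sum_comp]
  simp_rw [hcard]
  rw [← lintegral_block_sum_fin hτ (fun k => y (e k)) hf]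
  refine lintegral_congr fun w => congrArg f (funext fun x => ?_)
  rw [Finset.sum_filter, Finset.sum_filter, ← e.sum_comp]
  simp

lemma map_scaled_block_sum {K ι : Type*} [Fintype K] [DecidableEq K] [Fintype ι] {τ : ℝ}
    (hτ : 0 < τ) (y : ι → K) {c : K → ℝ} (hc : ∀ x, 0 < c x) :
    (Measure.pi fun _ : ι => expMeasure τ).map (fun w x => c x * ∑ p with y p = x, w p) =
      Measure.pi fun x => gammaLaw (Finset.univ.filter fun p => y p = x).card (τ / c x) := by
  have hp := isProbabilityMeasure_gammaLaw_natCast hτ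
  have hm : Measurable fun (w : ι → ℝ) (x : K) => ∑ p with y p = x, w p :=
    measurable_pi_lambda _ fun x => Finset.measurable_sum _ fun p _ => measurable_pi_apply p
  have hg : ∀ x, Measurable fun b : ℝ => c x * b := fun x => by fun_prop
  have := fun x => Measure.isProbabilityMeasure_map
    (μ := gammaLaw (Finset.univ.filter fun p => y p = x).card τ) (hg x).aemeasurable
  have h := Measure.pi_map_pi
    (μ := fun x => gammaLaw (Finset.univ.filter fun p => y p = x).card τ)
    (f := fun x (b : ℝ) => c x * b) fun x => (hg x).aemeasurable
  rw [← map_block_sum hτ y, Measure.map_map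
    (measurable_pi_lambda _ fun x => (measurable_pi_apply x).const_mul _) hm] at h
  refine h.trans ?_
  congr 1
  funext x
  exact map_const_mul_gammaLaw (by positivity) hτ (hc x)

section

variable {X : Type u} [MeasurableSpace X]

lemma occIndicator_nonneg {X : Type*} {L m : ℕ} (d : RankingData X L m) (l : Fin L) (i : Fin m) (x : X) :
    0 ≤ occIndicator d l i x := by
  unfold occIndicator
  split_ifs <;> norm_num

lemma totalRate_sub_nonneg {X : Type*} {L m : ℕ} (d : RankingData X L m) :
    0 ≤ ∑ l, ∑ i, max ((d l).2 i) 0 :=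
  Finset.sum_nonneg fun _ _ => Finset.sum_nonneg fun _ _ => le_max_right _ _

/-! ### The posterior kernel -/

/-- The list of all the items of a data set, repetitions included. -/
def items {L m : ℕ} (d : RankingData X L m) (p : Fin L × Fin m) : X := (d p.1).1 p.2

@[fun_prop]
lemma measurable_items {T : Type*} [MeasurableSpace T] {L m : ℕ} {d : T → RankingData X L m}
    (hd : Measurable d) : Measurable fun t => items (d t) :=
  measurable_pi_lambda _ fun p => measurable_pi_iff.1 (measurable_pi_iff.1 hd p.1).fst p.2

/-- The posterior rate of the continuous part, negative times being set to `0`. -/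
noncomputable def totalRate {L m : ℕ} (τ : ℝ) (d : RankingData X L m) : ℝ :=
  τ + ∑ l, ∑ i, max ((d l).2 i) 0

/-- The posterior rate of the weight of the item `x`, negative times being set to `0`. -/
noncomputable def itemRate {L m : ℕ} (τ : ℝ) (d : RankingData X L m) (x : X) : ℝ :=
  τ + ∑ l, ∑ i, occIndicator d l i x * max ((d l).2 i) 0

lemma itemRate_sub_nonneg {X : Type*} {L m : ℕ} (d : RankingData X L m) (x : X) :
    0 ≤ ∑ l, ∑ i, occIndicator d l i x * max ((d l).2 i) 0 :=
  Finset.sum_nonneg fun _ _ => Finset.sum_nonneg fun _ _ =>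
    mul_nonneg (occIndicator_nonneg _ _ _ _) (le_max_right _ _)

/-- Clipping the times at `0` keeps the rates positive at every data value, and changes nothing
where the times are nonnegative. -/
lemma totalRate_pos {X : Type*} {L m : ℕ} {τ : ℝ} (hτ : 0 < τ) (d : RankingData X L m) :
    0 < totalRate τ d :=
  add_pos_of_pos_of_nonneg hτ (totalRate_sub_nonneg d)

lemma itemRate_pos {X : Type*} {L m : ℕ} {τ : ℝ} (hτ : 0 < τ) (d : RankingData X L m) (x : X) :
    0 < itemRate τ d x :=
  add_pos_of_pos_of_nonneg hτ (itemRate_sub_nonneg d x)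

@[fun_prop]
lemma measurable_totalRate {L m : ℕ} (τ : ℝ) :
    Measurable fun d : RankingData X L m => totalRate τ d := by
  unfold totalRate
  fun_prop

lemma measurable_occIndicator [MeasurableEq X] {L m : ℕ} (l : Fin L) (i : Fin m)
    (p : Fin L × Fin m) :
    Measurable fun d : RankingData X L m => occIndicator d l i (items d p) := by
  classical
  have : MeasurableSet {d : RankingData X L m | ∃ j < i, (d l).1 j = items d p} := by
    have : {d : RankingData X L m | ∃ j < i, (d l).1 j = items d p} =
        ⋃ j, ⋃ (_ : j < i), {d : RankingData X L m | (d l).1 j = items d p} := by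
      ext d; simp
    rw [this]
    refine MeasurableSet.iUnion fun j => MeasurableSet.iUnion fun _ => measurableSet_eq_fun ?_ ?_
    · fun_prop
    · exact measurable_pi_iff.1 (measurable_items measurable_id) p
  unfold occIndicator
  convert Measurable.ite this (measurable_const (a := (0 : ℝ))) (measurable_const (a := (1 : ℝ)))

lemma measurable_itemRate [MeasurableEq X] {L m : ℕ} (τ : ℝ) (p : Fin L × Fin m) :
    Measurable fun d : RankingData X L m => itemRate τ d (items d p) := by
  unfold itemRate
  refine measurable_const.add (Finset.measurable_sum _ fun l _ =>
    Finset.measurable_sum _ fun i _ => (measurable_occIndicator l i p).mul ?_)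
  fun_prop

/-- The posterior value of the random measure, given its prior value `g` and exponential
variables `w`. -/
noncomputable def posteriorMeasure {L m : ℕ} (τ : ℝ) (d : RankingData X L m) (g : Measure X)
    (w : Fin L × Fin m → ℝ) : Measure X :=
  addAtoms (ENNReal.ofReal (τ / totalRate τ d) • g) (items d)
    fun p => τ / itemRate τ d (items d p) * w p

lemma measurable_posteriorMeasure [MeasurableEq X] {L m : ℕ} (τ : ℝ) :
    Measurable fun q : RankingData X L m × Measure X × (Fin L × Fin m → ℝ) =>
      posteriorMeasure τ q.1 q.2.1 q.2.2 := by
  refine measurable_addAtoms ?_ (measurable_items measurable_fst) ?_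
  · refine Measure.measurable_of_measurable_coe _ fun s hs => ?_
    simp only [Measure.smul_apply, smul_eq_mul]
    refine Measurable.mul ?_ ((Measure.measurable_coe hs).comp measurable_snd.fst)
    exact (measurable_const.div ((measurable_totalRate τ).comp measurable_fst)).ennreal_ofReal
  · refine measurable_pi_lambda _ fun p => Measurable.mul ?_ (by fun_prop)
    exact measurable_const.div ((measurable_itemRate τ p).comp measurable_fst)

/-- The posterior law of a gamma process of law `γ` and rate `τ`, given the data. -/
noncomputable def posteriorKernel (L m : ℕ) (τ : ℝ) (γ : Measure (Measure X)) :
    Kernel (RankingData X L m) (Measure X) :=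
  (Kernel.id ×ₖ Kernel.const _ (γ.prod (Measure.pi fun _ : Fin L × Fin m => expMeasure τ))).map
    fun q => posteriorMeasure τ q.1 q.2.1 q.2.2

section

variable [MeasurableEq X] {L m : ℕ} {τ : ℝ} {γ : Measure (Measure X)}

/-- The randomness `(g, w)` has a fixed law and the data enter only through `posteriorMeasure`, so
everything reduces to the joint measurability of that map. -/
lemma isMarkovKernel_posteriorKernel (hτ : 0 < τ) [IsProbabilityMeasure γ] :
    IsMarkovKernel (posteriorKernel L m τ γ) := by
  have : IsProbabilityMeasure (expMeasure τ) := isProbabilityMeasure_expMeasure hτ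
  exact Kernel.IsMarkovKernel.map _ (measurable_posteriorMeasure τ)

lemma posteriorKernel_apply [SFinite γ] (d : RankingData X L m) :
    posteriorKernel L m τ γ d =
      (γ.prod (Measure.pi fun _ => expMeasure τ)).map fun q => posteriorMeasure τ d q.1 q.2 := by
  rw [posteriorKernel, Kernel.map_apply _ (measurable_posteriorMeasure τ), Kernel.prod_apply,
    Kernel.id_apply, Kernel.const_apply, Measure.dirac_prod,
    Measure.map_map (measurable_posteriorMeasure τ) measurable_prodMk_left]
  rfl

lemma lintegral_posteriorKernel [SFinite γ] (d : RankingData X L m) {f : Measure X → ℝ≥0∞}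
    (hf : Measurable f) :
    ∫⁻ g, f g ∂posteriorKernel L m τ γ d =
      ∫⁻ g, ∫⁻ w, f (posteriorMeasure τ d g w) ∂Measure.pi (fun _ => expMeasure τ) ∂γ := by
  have hm : Measurable fun q : Measure X × (Fin L × Fin m → ℝ) => posteriorMeasure τ d q.1 q.2 :=
    Measurable.comp (g := fun q : RankingData X L m × Measure X × (Fin L × Fin m → ℝ) =>
      posteriorMeasure τ q.1 q.2.1 q.2.2) (f := fun q => (d, q)) (measurable_posteriorMeasure τ)
      measurable_prodMk_left
  have hfm : Measurable fun q : Measure X × (Fin L × Fin m → ℝ) =>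
      f (posteriorMeasure τ d q.1 q.2) := hf.comp hm
  rw [posteriorKernel_apply, lintegral_map hf hm, lintegral_prod _ hfm.aemeasurable]

/-- The scale applied to the weight at a position depends only on the item there. Merging the
positions of one item thus gives a scaled sum of i.i.d. exponentials, that is, a gamma weight whose
shape is the number of occurrences. -/
lemma isPosteriorLaw_posteriorKernel {α : ℝ} {H : Measure X} (hγ : IsGammaProcessLaw α τ H γ)
    (hα : 0 < α) (hτ : 0 < τ) (d : RankingData X L m) (hd : ∀ l i, 0 ≤ (d l).2 i) :
    IsPosteriorLaw α τ H d (posteriorKernel L m τ γ d) := by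
  classical
  have := hγ.isProbabilityMeasure
  have : IsProbabilityMeasure (expMeasure τ) := isProbabilityMeasure_expMeasure hτ
  have htot : totalRate τ d = τ + ∑ l, ∑ i, (d l).2 i := by
    simp only [totalRate, max_eq_left (hd _ _)]
  have hitem : ∀ x, itemRate τ d x = τ + ∑ l, ∑ i, occIndicator d l i x * (d l).2 i := by
    intro x
    simp only [itemRate, max_eq_left (hd _ _)]
  have hc : 0 < τ / totalRate τ d := div_pos hτ (totalRate_pos hτ d)
  refine ⟨γ.map fun g => ENNReal.ofReal (τ / totalRate τ d) • g, ?_, ?_⟩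
  · have h := hγ.map_smul hα hτ hc
    rw [div_div_cancel₀ hτ.ne'] at h
    rwa [← htot]
  have hmem : ∀ p, items d p ∈ observedItems d := fun p =>
    Finset.mem_image.2 ⟨p, Finset.mem_univ p, rfl⟩
  let y : Fin L × Fin m → observedItems d := fun p => ⟨items d p, hmem p⟩
  let c : observedItems d → ℝ := fun x => τ / itemRate τ d x
  have hcpos : ∀ x, 0 < c x := fun x => div_pos hτ (itemRate_pos hτ d x)
  have hocc : ∀ x : observedItems d,
      (Finset.univ.filter fun p => y p = x).card = occurrences d x := by
    intro x
    unfold occurrences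
    congr 1
    ext p
    simp [y, items, Subtype.ext_iff]
  have hpos : ∀ x : observedItems d, 0 < occurrences d x := by
    rintro ⟨x, hx⟩
    obtain ⟨p, -, rfl⟩ := Finset.mem_image.1 hx
    exact Finset.card_pos.2 ⟨p, by simp⟩
  have hpi : (Measure.pi fun x : observedItems d => gammaMeasure (occurrences d x)
      (τ + ∑ l, ∑ i, occIndicator d l i x * (d l).2 i)) =
      (Measure.pi fun _ => expMeasure τ).map fun w x => c x * ∑ p with y p = x, w p := by
    rw [map_scaled_block_sum hτ y hcpos]
    congr 1
    funext x
    rw [hocc, gammaLaw_of_pos (by exact_mod_cast hpos x), div_div_cancel₀ hτ.ne', hitem]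
  have hT : Measurable fun (w : Fin L × Fin m → ℝ) (x : observedItems d) =>
      c x * ∑ p with y p = x, w p :=
    measurable_pi_lambda _ fun x => (Finset.measurable_sum _ fun p _ =>
      measurable_pi_apply p).const_mul _
  have hs : Measurable fun g : Measure X => ENNReal.ofReal (τ / totalRate τ d) • g :=
    (smulMeasureEquiv X hc).measurable
  have hadd : Measurable fun q : Measure X × (observedItems d → ℝ) =>
      q.1 + ∑ x : observedItems d, ENNReal.ofReal (q.2 x) • Measure.dirac (x : X) := by
    have : Measurable fun q : Measure X × (observedItems d → ℝ) =>
        addAtoms q.1 (fun x : observedItems d => (x : X)) q.2 := by fun_prop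
    exact this
  rw [posteriorKernel_apply, hpi, Measure.map_prod_map _ _ hs hT,
    Measure.map_map hadd (hs.prodMap hT)]
  refine Measure.map_congr ?_
  -- Nonnegativity of the weights is needed because `ENNReal.ofReal` truncates at `0` and is
  -- additive only on nonnegative reals.
  have hw : ∀ᵐ q ∂γ.prod (Measure.pi fun _ : Fin L × Fin m => expMeasure τ), ∀ p, 0 ≤ q.2 p :=
    Measure.quasiMeasurePreserving_snd.ae (ae_nonneg_pi_expMeasure τ)
  filter_upwards [hw] with q hq
  simp only [posteriorMeasure, addAtoms, Function.comp_apply, Prod.map_snd, Prod.map_fst]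
  congr 1
  rw [← Finset.sum_fiberwise Finset.univ y]
  refine Finset.sum_congr rfl fun x _ => ?_
  rw [Finset.mul_sum, ENNReal.ofReal_sum_of_nonneg fun p _ => mul_nonneg (hcpos x).le (hq p),
    Finset.sum_smul]
  refine Finset.sum_congr rfl fun p hp => ?_
  obtain rfl := (Finset.mem_filter.1 hp).2
  rfl

end

/-! ### Disintegration of the joint law -/

/-- Exponential tilting of independent exponential variables. -/
lemma lintegral_prod_exp_mul_pi_expMeasure {ι : Type*} [Fintype ι] {τ : ℝ} (hτ : 0 < τ) {r : ι → ℝ}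
    (hr : ∀ i, 0 ≤ r i) {f : (ι → ℝ) → ℝ≥0∞} (hf : Measurable f) :
    ∫⁻ w, (∏ i, ENNReal.ofReal (Real.exp (-(r i * w i)))) * f w
      ∂Measure.pi (fun _ => expMeasure τ) =
    (∏ i, ENNReal.ofReal (τ / (τ + r i))) * ∫⁻ w, f (fun i => τ / (τ + r i) * w i)
      ∂Measure.pi (fun _ => expMeasure τ) := by
  have hc : ∀ i, 0 < τ / (τ + r i) := fun i => by have := hr i; positivity
  have he : ∀ i, Measurable fun w : ℝ => ENNReal.ofReal (Real.exp (-(r i * w))) := fun i => by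
    fun_prop
  have hs : Measurable fun (w : ι → ℝ) i => τ / (τ + r i) * w i := by fun_prop
  have hone : ∀ i {S : Set ℝ}, MeasurableSet S →
      (expMeasure τ).withDensity (fun w => ENNReal.ofReal (Real.exp (-(r i * w)))) S =
        ENNReal.ofReal (τ / (τ + r i)) * expMeasure τ ((fun w => τ / (τ + r i) * w) ⁻¹' S) := by
    intro i S hS
    have h := lintegral_exp_mul_gammaLaw zero_le_one hτ (hr i) (f := S.indicator 1)
      (measurable_one.indicator hS)
    have hm : Measurable fun w : ℝ => τ / (τ + r i) * w := by fun_prop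
    have hmap := map_const_mul_gammaLaw zero_le_one hτ (hc i)
    rw [div_div_cancel₀ hτ.ne'] at hmap
    rw [Real.rpow_one, lintegral_indicator_one hS, ← hmap, Measure.map_apply hm hS] at h
    rw [withDensity_apply _ hS, ← lintegral_indicator hS, expMeasure_eq_gammaLaw, ← h]
    refine lintegral_congr fun w => ?_
    by_cases hw : w ∈ S <;> simp [hw]
  have hσ : ∀ i, SigmaFinite ((expMeasure τ).withDensity
      fun w => ENNReal.ofReal (Real.exp (-(r i * w)))) := fun i =>
    SigmaFinite.withDensity_of_ne_top (ae_of_all _ fun w => ENNReal.ofReal_ne_top)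
  have h1 := pi_withDensity (fun _ : ι => expMeasure τ) he
  have h2 : Measure.pi (fun i => (expMeasure τ).withDensity
      fun w => ENNReal.ofReal (Real.exp (-(r i * w)))) =
      (∏ i, ENNReal.ofReal (τ / (τ + r i))) •
        (Measure.pi fun _ : ι => expMeasure τ).map fun w i => τ / (τ + r i) * w i := by
    refine Measure.pi_eq fun S hS => ?_
    rw [Measure.smul_apply, Measure.map_apply hs (MeasurableSet.univ_pi hS), smul_eq_mul]
    have : (fun (w : ι → ℝ) i => τ / (τ + r i) * w i) ⁻¹' Set.univ.pi S =
        Set.univ.pi fun i => (fun w => τ / (τ + r i) * w) ⁻¹' S i := by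
      ext w; simp
    rw [this, Measure.pi_pi, ← Finset.prod_mul_distrib]
    exact Finset.prod_congr rfl fun i _ => (hone i (hS i)).symm
  have hprod : Measurable fun w : ι → ℝ => ∏ i, ENNReal.ofReal (Real.exp (-(r i * w i))) := by
    fun_prop
  have h3 := lintegral_withDensity_eq_lintegral_mul
    (Measure.pi fun _ : ι => expMeasure τ) hprod hf
  simp only [Pi.mul_apply] at h3
  rw [← h3, ← h1, h2, lintegral_smul_measure, lintegral_map hf hs, smul_eq_mul]

variable [MeasurableEq X] {L m : ℕ}

lemma indicator_remaining {X : Type*} (d : RankingData X L m) (l : Fin L) (i : Fin m) (x : X) :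
    (remaining (d l).1 i).indicator 1 x = ENNReal.ofReal (occIndicator d l i x) := by
  classical
  by_cases hx : ∃ j < i, (d l).1 j = x
  · have : x ∉ remaining (d l).1 i := by
      obtain ⟨j, hj, h⟩ := hx
      exact fun h' => h' j hj h
    simp [occIndicator, if_pos hx, this]
  · have : x ∈ remaining (d l).1 i := fun j hj h => hx ⟨j, hj, h⟩
    simp [occIndicator, if_neg hx, this]

/-- The mass remaining at a stage, after adding atoms at the items of the lists. -/
lemma toReal_addAtoms_remaining {g : Measure X} (hg : g Set.univ < ∞) (d : RankingData X L m)
    (hg0 : ∀ p, g {items d p} = 0) {w : Fin L × Fin m → ℝ} (hw : ∀ p, 0 ≤ w p) (l : Fin L)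
    (i : Fin m) :
    (massKernel X (addAtoms g (items d) w) (remaining (d l).1 i)).toReal =
      (g Set.univ).toReal + ∑ p, w p * occIndicator d l i (items d p) := by
  have hR := measurableSet_remaining (d l).1 i
  have hgR : g (remaining (d l).1 i) = g Set.univ := by
    -- Only finitely many items have been removed, and `g` charges none of them.
    have h0 : g (remaining (d l).1 i)ᶜ = 0 := by
      refine measure_mono_null (t := ⋃ j, {items d (l, j)}) ?_ (measure_iUnion_null fun j => hg0 _)
      intro x hx
      simp only [remaining, Set.mem_compl_iff, Set.mem_ofPred_eq, not_forall, not_not] at hx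
      obtain ⟨j, -, rfl⟩ := hx
      exact Set.mem_iUnion.2 ⟨j, rfl⟩
    rw [← measure_add_measure_compl hR, h0, add_zero]
  rw [massKernel_apply (addAtoms_univ_lt_top hg _ _), addAtoms_apply _ _ _ hR, hgR]
  have hterm : ∀ p, ENNReal.ofReal (w p) * (remaining (d l).1 i).indicator 1 (items d p) =
      ENNReal.ofReal (w p * occIndicator d l i (items d p)) := fun p => by
    rw [indicator_remaining, ENNReal.ofReal_mul (hw p)]
  simp_rw [hterm]
  have hnn : ∀ p ∈ Finset.univ, 0 ≤ w p * occIndicator d l i (items d p) := fun p _ =>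
    mul_nonneg (hw p) (occIndicator_nonneg _ _ _ _)
  rw [← ENNReal.ofReal_sum_of_nonneg hnn, ENNReal.toReal_add hg.ne ENNReal.ofReal_ne_top,
    ENNReal.toReal_ofReal (Finset.sum_nonneg hnn)]

/-- The indicator of the data sets all of whose lists have distinct items. -/
noncomputable def distinctIndicator {X : Type*} {L m : ℕ} (d : RankingData X L m) : ℝ≥0∞ :=
  ∏ l, {y : Fin m → X | Function.Injective y}.indicator 1 (d l).1

@[fun_prop]
lemma measurable_distinctIndicator :
    Measurable fun d : RankingData X L m => distinctIndicator d :=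
  Finset.measurable_prod _ fun l _ =>
    (measurable_one.indicator measurableSet_injective).comp (measurable_pi_apply l).fst

/-- Every remaining mass is `g(X)` plus a linear combination of the weights, so the exponential of
their sum factors into one term in `g(X)` and one in each `wₚ`, ready for separate tiltings. -/
lemma dataDensity_addAtoms {g : Measure X} (hg : g Set.univ < ∞) (d : RankingData X L m)
    (hg0 : ∀ p, g {items d p} = 0) {w : Fin L × Fin m → ℝ} (hw : ∀ p, 0 ≤ w p)
    (hd : ∀ l i, 0 ≤ (d l).2 i) :
    dataDensity (addAtoms g (items d) w) d = distinctIndicator d *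
      (ENNReal.ofReal (Real.exp (-((∑ l, ∑ i, max ((d l).2 i) 0) * (g Set.univ).toReal))) *
        ∏ p, ENNReal.ofReal (Real.exp
          (-((∑ l, ∑ i, occIndicator d l i (items d p) * max ((d l).2 i) 0) * w p)))) := by
  have hexp : ∀ x : ℝ, 0 ≤ Real.exp x := fun x => (Real.exp_pos x).le
  simp only [max_eq_left (hd _ _)]
  rw [dataDensity]
  simp only [rankingDensity, toReal_addAtoms_remaining hg d hg0 hw]
  rw [Finset.prod_mul_distrib, distinctIndicator,
    ← ENNReal.ofReal_prod_of_nonneg fun _ _ => hexp _,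
    ← ENNReal.ofReal_prod_of_nonneg fun _ _ => hexp _, ← ENNReal.ofReal_mul (hexp _),
    ← Real.exp_sum, ← Real.exp_sum, ← Real.exp_add, Finset.sum_neg_distrib,
    Finset.sum_neg_distrib, ← neg_add]
  congr 4
  simp only [mul_add, Finset.sum_add_distrib, Finset.sum_mul, Finset.mul_sum]
  congr 1
  rw [Finset.sum_congr rfl fun l _ => Finset.sum_comm, Finset.sum_comm]
  exact Finset.sum_congr rfl fun p _ => Finset.sum_congr rfl fun l _ =>
    Finset.sum_congr rfl fun i _ => by ring

/-- The density of the marginal law of the data. -/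
noncomputable def evidence {X : Type*} {L m : ℕ} (α τ : ℝ) (d : RankingData X L m) : ℝ≥0∞ :=
  distinctIndicator d * (ENNReal.ofReal ((τ / totalRate τ d) ^ α) *
    ∏ p, ENNReal.ofReal (τ / itemRate τ d (items d p)))

lemma measurable_evidence (α τ : ℝ) :
    Measurable fun d : RankingData X L m => evidence α τ d := by
  unfold evidence
  refine Measurable.mul (by fun_prop) (Measurable.mul (by fun_prop) ?_)
  exact Finset.measurable_prod _ fun p _ =>
    (measurable_const.div (measurable_itemRate τ p)).ennreal_ofReal

variable {α τ : ℝ} {H : Measure X} {γ : Measure (Measure X)}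

namespace IsGammaProcessLaw

/-- Bayes' formula at fixed data. The factors of the density tilt `g` and each `wₚ` independently,
which rescales them into `posteriorMeasure`; the normalising constants and the distinctness
indicator are collected in `evidence`. -/
lemma lintegral_dataDensity_addAtoms (hγ : IsGammaProcessLaw α τ H γ) (hα : 0 < α) (hτ : 0 < τ)
    [IsProbabilityMeasure H] [NullSingletonClass H] (d : RankingData X L m)
    (hd : ∀ l i, 0 ≤ (d l).2 i) {f : Measure X → ℝ≥0∞} (hf : Measurable f) :
    ∫⁻ g, ∫⁻ w, dataDensity (addAtoms g (items d) w) d * f (addAtoms g (items d) w)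
      ∂Measure.pi (fun _ => expMeasure τ) ∂γ =
    evidence α τ d * ∫⁻ g, f g ∂posteriorKernel L m τ γ d := by
  have := hγ.isProbabilityMeasure
  have : IsProbabilityMeasure (expMeasure τ) := isProbabilityMeasure_expMeasure hτ
  have hg0 : ∀ᵐ g ∂γ, ∀ p, g {items d p} = 0 := by
    rw [ae_all_iff]
    exact fun p => hγ.ae_eq_zero (measurableSet_singleton _) (measure_singleton _)
  let Z : ℝ := ∑ l, ∑ i, max ((d l).2 i) 0
  let r : Fin L × Fin m → ℝ := fun p =>
    ∑ l, ∑ i, occIndicator d l i (items d p) * max ((d l).2 i) 0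
  have hfm : Measurable fun p : Measure X × (Fin L × Fin m → ℝ) =>
      f (addAtoms p.1 (items d) p.2) := by fun_prop
  have hm : Measurable fun p : Measure X × (Fin L × Fin m → ℝ) =>
      (∏ q, ENNReal.ofReal (Real.exp (-(r q * p.2 q)))) * f (addAtoms p.1 (items d) p.2) := by
    refine Measurable.mul ?_ hfm
    fun_prop
  have h1 : ∫⁻ g, ∫⁻ w, dataDensity (addAtoms g (items d) w) d * f (addAtoms g (items d) w)
      ∂Measure.pi (fun _ => expMeasure τ) ∂γ =
      ∫⁻ g, distinctIndicator d * (ENNReal.ofReal (Real.exp (-(Z * (g Set.univ).toReal))) *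
        ∫⁻ w, (∏ p, ENNReal.ofReal (Real.exp (-(r p * w p)))) * f (addAtoms g (items d) w)
          ∂Measure.pi (fun _ => expMeasure τ)) ∂γ := by
    refine lintegral_congr_ae ?_
    filter_upwards [hg0, hγ.ae_lt_top] with g hg0 hg
    have hmg : Measurable fun w : Fin L × Fin m → ℝ =>
        (∏ p, ENNReal.ofReal (Real.exp (-(r p * w p)))) * f (addAtoms g (items d) w) :=
      Measurable.mul (by fun_prop) (by fun_prop)
    rw [← lintegral_const_mul _ hmg, ← lintegral_const_mul _ (hmg.const_mul _)]
    refine lintegral_congr_ae ?_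
    filter_upwards [ae_nonneg_pi_expMeasure τ] with w hw
    rw [dataDensity_addAtoms hg d hg0 hw hd]
    simp only [Z, r, mul_assoc]
  have hmz : Measurable fun g : Measure X =>
      ENNReal.ofReal (Real.exp (-(Z * (g Set.univ).toReal))) :=
    (((Measure.measurable_coe .univ).ennreal_toReal.const_mul Z).neg.exp).ennreal_ofReal
  have hmG : Measurable fun g : Measure X =>
      ∫⁻ w, (∏ p, ENNReal.ofReal (Real.exp (-(r p * w p)))) * f (addAtoms g (items d) w)
        ∂Measure.pi (fun _ => expMeasure τ) := hm.lintegral_prod_right'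
  rw [h1, lintegral_const_mul _ (hmz.fun_mul hmG),
    hγ.lintegral_exp_mul hα hτ (totalRate_sub_nonneg d) hmG]
  have h2 : ∀ g : Measure X,
      ∫⁻ w, (∏ p, ENNReal.ofReal (Real.exp (-(r p * w p)))) * f (addAtoms g (items d) w)
        ∂Measure.pi (fun _ => expMeasure τ) =
      (∏ p, ENNReal.ofReal (τ / (τ + r p))) *
        ∫⁻ w, f (addAtoms g (items d) fun p => τ / (τ + r p) * w p)
          ∂Measure.pi (fun _ => expMeasure τ) := fun g =>
    lintegral_prod_exp_mul_pi_expMeasure hτ (fun p => itemRate_sub_nonneg d _)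
      (f := fun w => f (addAtoms g (items d) w)) (by fun_prop)
  simp_rw [h2]
  have hc : 0 < τ / (τ + Z) := div_pos hτ (totalRate_pos hτ d)
  have hpost : Measurable fun p : Measure X × (Fin L × Fin m → ℝ) =>
      f (addAtoms (ENNReal.ofReal (τ / (τ + Z)) • p.1) (items d)
        fun q => τ / (τ + r q) * p.2 q) := by
    refine hf.comp (measurable_addAtoms ?_ measurable_const (by fun_prop))
    exact (smulMeasureEquiv X hc).measurable.comp measurable_fst
  rw [lintegral_const_mul _ hpost.lintegral_prod_right', lintegral_posteriorKernel d hf, evidence]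
  simp only [mul_assoc]
  rfl

/-- The disintegration of the joint law of the data and the gamma process. -/
theorem exists_disintegration (hγ : IsGammaProcessLaw α τ H γ) (hα : 0 < α) (hτ : 0 < τ)
    [IsProbabilityMeasure H] [NullSingletonClass H] (L m : ℕ) :
    ∃ ν : Measure (RankingData X L m), ∀ f : RankingData X L m × Measure X → ℝ≥0∞, Measurable f →
      ∫⁻ g, ∫⁻ d, f (d, g) ∂dataLaw L m g ∂γ =
        ∫⁻ d, ∫⁻ g, f (d, g) ∂posteriorKernel L m τ γ d ∂ν := by
  have := hγ.isProbabilityMeasure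
  have : IsProbabilityMeasure (expMeasure τ) := isProbabilityMeasure_expMeasure hτ
  have := isMarkovKernel_posteriorKernel (X := X) (L := L) (m := m) (γ := γ) hτ
  obtain ⟨Λ, hΛ, hmecke⟩ := hγ.exists_mecke hα hτ (Fin L × Fin m)
  have ha : Measurable fun p : (Fin L × Fin m → X) × (Fin L × Fin m → ℝ) =>
      assemble p.1 p.2 := by fun_prop
  -- The locations come from the urn measure `Λ`, the times from Lebesgue measure, and `evidence` is
  -- what the tilting leaves over.
  refine ⟨((Λ.prod (Measure.pi fun _ => halfLine)).map fun p => assemble p.1 p.2).withDensity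
    (evidence α τ), fun f hf => ?_⟩
  have hfin : ∀ᵐ g ∂γ, ∫⁻ d, f (d, g) ∂dataLaw L m g =
      ∫⁻ y, ∫⁻ z, dataDensity g (assemble y z) * f (assemble y z, g)
        ∂Measure.pi (fun _ => halfLine) ∂massPiKernel (Fin L × Fin m) X g := by
    -- Finiteness undoes the truncation in `massKernel`; the series representation provides the
    -- countable support.
    filter_upwards [hγ.ae_lt_top, hγ.atomic] with g hg hat
    obtain ⟨w, x, -, hgx⟩ := hat
    have : IsFiniteMeasure g := ⟨hg⟩
    have h0 : g (Set.range x)ᶜ = 0 := by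
      rw [hgx, Measure.sum_apply _ (Set.countable_range x).measurableSet.compl]
      simp
    rw [lintegral_dataLaw g (Set.countable_range x) h0 (f := fun d => f (d, g)) (by fun_prop),
      massPiKernel_apply, massKernel_apply hg]
  rw [lintegral_congr_ae hfin]
  have hm1 : Measurable fun p : (Measure X × (Fin L × Fin m → X)) × (Fin L × Fin m → ℝ) =>
      dataDensity p.1.1 (assemble p.1.2 p.2) * f (assemble p.1.2 p.2, p.1.1) :=
    Measurable.mul (by fun_prop) (by fun_prop)
  rw [hmecke (fun p => ∫⁻ z, dataDensity p.1 (assemble p.2 z) * f (assemble p.2 z, p.1)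
    ∂Measure.pi (fun _ => halfLine)) hm1.lintegral_prod_right']
  have hK : Measurable fun d : RankingData X L m => ∫⁻ g, f (d, g) ∂posteriorKernel L m τ γ d :=
    hf.lintegral_kernel_prod_right'
  have hev : Measurable (evidence α τ : RankingData X L m → ℝ≥0∞) := measurable_evidence α τ
  have hevK : Measurable fun d : RankingData X L m =>
      evidence α τ d * ∫⁻ g, f (d, g) ∂posteriorKernel L m τ γ d := hev.mul hK
  have hevKa : Measurable fun p : (Fin L × Fin m → X) × (Fin L × Fin m → ℝ) =>
      evidence α τ (assemble p.1 p.2) *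
        ∫⁻ g, f (assemble p.1 p.2, g) ∂posteriorKernel L m τ γ (assemble p.1 p.2) := hevK.comp ha
  rw [lintegral_withDensity_eq_lintegral_mul _ hev hK]
  simp only [Pi.mul_apply]
  rw [lintegral_map hevK ha, lintegral_prod _ hevKa.aemeasurable]
  refine lintegral_congr fun y => ?_
  have hm2 : Measurable fun p : (Measure X × (Fin L × Fin m → ℝ)) × (Fin L × Fin m → ℝ) =>
      dataDensity (addAtoms p.1.1 y p.1.2) (assemble y p.2) *
        f (assemble y p.2, addAtoms p.1.1 y p.1.2) :=
    Measurable.mul (by fun_prop) (by fun_prop)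
  have hm3 : Measurable fun p : (Measure X × (Fin L × Fin m → ℝ)) × (Fin L × Fin m → ℝ) =>
      dataDensity (addAtoms p.1.1 y p.2) (assemble y p.1.2) *
        f (assemble y p.1.2, addAtoms p.1.1 y p.2) :=
    Measurable.mul (by fun_prop) (by fun_prop)
  -- The times are moved outside so that the tilting is performed with the whole data set fixed.
  have hswap : ∀ g : Measure X,
      ∫⁻ w, ∫⁻ z, dataDensity (addAtoms g y w) (assemble y z) * f (assemble y z, addAtoms g y w)
        ∂Measure.pi (fun _ => halfLine) ∂Measure.pi (fun _ => expMeasure τ) =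
      ∫⁻ z, ∫⁻ w, dataDensity (addAtoms g y w) (assemble y z) * f (assemble y z, addAtoms g y w)
        ∂Measure.pi (fun _ => expMeasure τ) ∂Measure.pi (fun _ => halfLine) := fun g =>
    lintegral_lintegral_swap (hm2.comp
      (f := fun p : (Fin L × Fin m → ℝ) × (Fin L × Fin m → ℝ) => ((g, p.1), p.2))
      (by fun_prop)).aemeasurable
  simp_rw [hswap]
  rw [lintegral_lintegral_swap hm3.lintegral_prod_right'.aemeasurable]
  have hz : ∀ᵐ z ∂Measure.pi (fun _ : Fin L × Fin m => halfLine), ∀ p, 0 ≤ z p := by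
    rw [ae_all_iff]
    intro p
    refine (Measure.quasiMeasurePreserving_eval (fun _ : Fin L × Fin m => halfLine) p).ae
      (p := fun b : ℝ => 0 ≤ b) ?_
    exact ae_restrict_mem measurableSet_Ici
  refine lintegral_congr_ae ?_
  filter_upwards [hz] with z hz
  exact hγ.lintegral_dataDensity_addAtoms hα hτ (assemble y z) (fun l i => hz (l, i))
    (f := fun g => f (assemble y z, g)) (by fun_prop)

end IsGammaProcessLaw

end

/-! ### The conditional law of the process given the data -/

theorem theorem2 {Ω X : Type*} [MeasurableSpace Ω] [MeasurableSpace X] [MeasurableEq X]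
    (P : Measure Ω) [IsProbabilityMeasure P]
    (α τ : ℝ) (hα : 0 < α) (hτ : 0 < τ)
    (H : Measure X) [IsProbabilityMeasure H] [NullSingletonClass H]
    (L m : ℕ)
    (G : Ω → Measure X) (hG : Measurable G)
    (Y : Fin L → Ω → (Fin m → X)) (hY : ∀ l, Measurable (Y l))
    (Z : Fin L → Ω → (Fin m → ℝ)) (hZ : ∀ l, Measurable (Z l))
    (prior : IsGammaProcessLaw α τ H (P.map G))
    (model : IsCondLaw P G (fun ω l => (Y l ω, Z l ω)) (dataLaw L m)) :
    ∃ κ : Kernel (RankingData X L m) (Measure X),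
      IsMarkovKernel κ ∧
      (∀ d : RankingData X L m, (∀ l i, 0 ≤ (d l).2 i) → IsPosteriorLaw α τ H d (κ d)) ∧
      IsCondLaw P (fun ω l => (Y l ω, Z l ω)) G κ := by
  have := prior.isProbabilityMeasure
  have hU : Measurable fun ω l => (Y l ω, Z l ω) :=
    measurable_pi_lambda _ fun l => (hY l).prodMk (hZ l)
  have hκ : IsMarkovKernel (posteriorKernel L m τ (P.map G)) := isMarkovKernel_posteriorKernel hτ
  refine ⟨posteriorKernel L m τ (P.map G), hκ,
    fun d hd => isPosteriorLaw_posteriorKernel prior hα hτ d hd,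
    (Kernel.measurable _).aemeasurable, ?_⟩
  obtain ⟨ν, hν⟩ := prior.exists_disintegration hα hτ L m
  have hjoint : ∀ {A : Set (RankingData X L m)} {B : Set (Measure X)}, MeasurableSet A →
      MeasurableSet B → P ((fun ω l => (Y l ω, Z l ω)) ⁻¹' A ∩ G ⁻¹' B) =
        ∫⁻ d in A, posteriorKernel L m τ (P.map G) d B ∂ν := by
    intro A B hA hB
    -- Measurability of `g ↦ dataLaw L m g` is part of the statement that it is a conditional law.
    have hdm : AEMeasurable (fun g => dataLaw L m g A) (P.map G) :=
      (Measure.measurable_coe hA).comp_aemeasurable model.1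
    have h := hν ((A ×ˢ B).indicator 1) (measurable_one.indicator (hA.prod hB))
    have hL : ∀ g, ∫⁻ d, (A ×ˢ B).indicator 1 (d, g) ∂dataLaw L m g =
        B.indicator (fun g => dataLaw L m g A) g := by
      intro g
      by_cases hg : g ∈ B
      · rw [Set.indicator_of_mem hg, ← lintegral_indicator_one hA]
        refine lintegral_congr fun d => ?_
        by_cases hd : d ∈ A <;> simp [hd, hg]
      · rw [Set.indicator_of_notMem hg, ← lintegral_zero (μ := dataLaw L m g)]
        exact lintegral_congr fun d => by simp [hg]
    have hR : ∀ d, ∫⁻ g, (A ×ˢ B).indicator 1 (d, g) ∂posteriorKernel L m τ (P.map G) d =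
        A.indicator (fun d => posteriorKernel L m τ (P.map G) d B) d := by
      intro d
      by_cases hd : d ∈ A
      · rw [Set.indicator_of_mem hd, ← lintegral_indicator_one hB]
        refine lintegral_congr fun g => ?_
        by_cases hg : g ∈ B <;> simp [hd, hg]
      · rw [Set.indicator_of_notMem hd,
          ← lintegral_zero (μ := posteriorKernel L m τ (P.map G) d)]
        exact lintegral_congr fun g => by simp [hd]
    simp_rw [hL, hR] at h
    rw [lintegral_indicator hB, lintegral_indicator hA] at h
    rw [Set.inter_comm, model.2 B A hB hA, ← h, Measure.restrict_map hG hB, lintegral_map'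
      (by rw [← Measure.restrict_map hG hB]; exact hdm.restrict) hG.aemeasurable]
  -- Taking `B` to be everything identifies `ν`, because the posterior kernel has total mass one.
  have hmarg : P.map (fun ω l => (Y l ω, Z l ω)) = ν := by
    ext A hA
    have h := hjoint hA .univ
    simp only [measure_univ, Set.preimage_univ, Set.inter_univ, setLIntegral_one] at h
    rw [Measure.map_apply hU hA, h]
  intro A B hA hB
  rw [hjoint hA hB, ← hmarg, setLIntegral_map hA (Kernel.measurable_coe _ hB) hU]
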